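/- Let $K\ge 2$, let $q_0\in\mathbb R^K$ have positive entries with sum $1$, and let $C_0\in(0,1)^{K\times K}$ be an invertible matrix whose columns sum to $1$. **Data.** For sample sizes $n^S_1,\dots,n^S_K,n'\in\mathbb N$ with $N=n'+\sum_i n^S_i$, the data consist of independent count vectors $\mathbf n^S_i\sim\mathrm{Multi}(n^S_i,(C_0)_{:,i})$ for $i=1,\dots,K$ and $\tilde{\mathbf n}\sim\mathrm{Multi}(n',C_0q_0)$. Their joint law is denoted by $\mathbb P_{(q_0,C_0)}$. **Label graph.** $W\in[0,1]^{K\times K}$ is a symmetric weight matrix whose graph (distinct $i,j$ are adjacent iff $W_{ij}\neq0$) is connected. $L=D-W$, with $D$ diagonal and $D_{ii}=\sum_jW_{ij}$, is its Laplacian, and $\lambda_2(L)$ is the smallest positive eigenvalue of $L$. **Prior.** On $\mathcal H=\{v\in\mathbb R^K:\sum_iv_i=0\}$ let $\mathcal N(0,(\tau L)^\dagger)$ be the Gaussian law with Lebesgue density proportional to $\exp(-\tfrac{\tau}{2}v^\top Lv)$. Independently, $\tau_q$ is either a fixed positive number or $\mathrm{Gamma}(a_q,b_q)$ distributed, and $\tau_C\sim\mathrm{Gamma}(a_C,b_C)$,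 where $a_q,b_q,a_C,b_C>0$. Given $(\tau_q,\tau_C)$, the vectors $\theta\sim\mathcal N(0,(\tau_qL)^\dagger)$ and $\phi_1,\dots,\phi_K\sim\mathcal N(0,(\tau_CL)^\dagger)$ are independent. Put $q=\mathrm{softmax}(\theta)$ and $C_{:,i}=\mathrm{softmax}(\phi_i)$. The posterior $\Pi(\cdot\mid\text{data})$ is obtained by Bayes' rule from this prior and the likelihood $\prod_i\mathrm{Multi}(\mathbf n_i^S;n_i^S,C_{:,i})\cdot\mathrm{Multi}(\tilde{\mathbf n};n',Cq)$, and $\mathrm{Var}_N(q_i)$ is the variance of $q_i$ under it. **Claim.** There is a constant $C>0$, depending only on $(q_0,C_0)$ and $K$, such that the following holds for every such $W$, every such choice of the prior of $\tau_q$, all $a_C,b_C>0$ and every $\rho>0$. For every $\delta>0$ there is $N_0$ such that for all sample sizes with $N\ge N_0$, $n'\ge\rho N$ and $n_i^S\ge\rho N$ for all $i$, with $\mathbb P_{(q_0,C_0)}$-probability at least $1-\delta$ the posterior is a well-defined probability measure and $$\mathrm{Var}_N(q_i)\le\frac{C}{\rho\,\lambda_2(L)\,N}\qquad\text{for all } i\in\{1,\dots,K\}.$$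 In particular, when all sample sizes are at least a fixed fraction of $N$, the bound $O\big(1/(\lambda_2(L)N)\big)$ holds with probability tending to one as $N\to\infty$. -/

import Mathlib

open MeasureTheory ProbabilityTheory

namespace GSBBSE

noncomputable section

/-! ### Multinomial likelihood -/

/-- The probability of the count vector `k` under the multinomial law with `n` trials and cell
probabilities `p`. -/
def multinomialProb {K : ℕ} (n : ℕ) (p : Fin K → ℝ) (k : Fin K → ℕ) : ℝ :=
  if ∑ j, k j = n then (Nat.multinomial Finset.univ k : ℝ) * ∏ j, p j ^ k j else 0

/-- A data set: `d.1 i j` is the number of source points of true class `i` that the classifier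
labels `j`, and `d.2 j` is the number of target points that the classifier labels `j`. -/
abbrev Data (K : ℕ) : Type := (Fin K → Fin K → ℕ) × (Fin K → ℕ)

/-- The complete-data likelihood of `(q, C)`: for each class `i` the source counts are
multinomial with `nS i` trials and cell probabilities the `i`-th column of `C`, the target counts
are multinomial with `nT` trials and cell probabilities `C q`, all of them independent. -/
def likelihood {K : ℕ} (nS : Fin K → ℕ) (nT : ℕ) (q : Fin K → ℝ)
    (C : Matrix (Fin K) (Fin K) ℝ) (d : Data K) : ℝ :=
  (∏ i, multinomialProb (nS i) (fun j => C j i) (d.1 i)) *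
    multinomialProb nT (Matrix.mulVec C q) d.2

/-- The sampling law of the data under the parameter `(q, C)`. -/
def dataLaw {K : ℕ} (nS : Fin K → ℕ) (nT : ℕ) (q : Fin K → ℝ)
    (C : Matrix (Fin K) (Fin K) ℝ) : Measure (Data K) :=
  Measure.count.withDensity fun d => ENNReal.ofReal (likelihood nS nT q C d)

/-! ### The label graph -/

/-- The unnormalised graph Laplacian `D - W` of a weight matrix `W`. -/
def laplacian {K : ℕ} (W : Matrix (Fin K) (Fin K) ℝ) : Matrix (Fin K) (Fin K) ℝ :=
  Matrix.diagonal (fun i => ∑ j, W i j) - W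

/-- `W` is the weight matrix of a connected undirected similarity graph on the labels, with
weights in `[0, 1]`; two distinct labels are joined by an edge when their weight is non-zero. -/
structure IsConnectedLabelGraph {K : ℕ} (W : Matrix (Fin K) (Fin K) ℝ) : Prop where
  symm : W.IsSymm
  nonneg : ∀ i j, 0 ≤ W i j
  le_one : ∀ i j, W i j ≤ 1
  connected : (SimpleGraph.fromRel fun i j => W i j ≠ 0).Connected

/-- The algebraic connectivity: the smallest positive eigenvalue of `L`. -/
def lambda2 {K : ℕ} (L : Matrix (Fin K) (Fin K) ℝ) : ℝ :=
  sInf {l : ℝ | 0 < l ∧ Module.End.HasEigenvalue (Matrix.toLin' L) l}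

/-! ### The hierarchical prior -/

/-- The space of centred log-odds vectors. -/
def centred (K : ℕ) : Submodule ℝ (EuclideanSpace ℝ (Fin K)) where
  carrier := {v | ∑ i, v i = 0}
  add_mem' := by
    intro a b ha hb
    simp only [Set.mem_ofPred_eq] at ha hb ⊢
    simp [Finset.sum_add_distrib, ha, hb]
  zero_mem' := by simp
  smul_mem' := by
    intro c a ha
    simp only [Set.mem_ofPred_eq] at ha ⊢
    simp [← Finset.mul_sum, ha]

/-- Lebesgue measure on the `(K - 1)`-dimensional Euclidean space of centred vectors. -/
def centredLebesgue (K : ℕ) : Measure (centred K) :=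
  (stdOrthonormalBasis ℝ (centred K)).toBasis.addHaar

/-- The softmax map. -/
def softmax {K : ℕ} (v : EuclideanSpace ℝ (Fin K)) (i : Fin K) : ℝ :=
  Real.exp (v i) / ∑ j, Real.exp (v j)

/-- `exp (-(τ / 2) vᵀ L v)`. -/
def gmrfWeight {K : ℕ} (L : Matrix (Fin K) (Fin K) ℝ) (τ : ℝ) (v : centred K) : ENNReal :=
  ENNReal.ofReal (Real.exp (-(τ / 2) *
    ∑ i, ∑ j, (v : EuclideanSpace ℝ (Fin K)) i * L i j * (v : EuclideanSpace ℝ (Fin K)) j))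

/-- The density, with respect to Lebesgue measure on the centred vectors, of the Gaussian Markov
random field with precision `τ L`, i.e. of the centred Gaussian law with covariance the
pseudo-inverse of `τ L`. -/
def gmrfDensity {K : ℕ} (L : Matrix (Fin K) (Fin K) ℝ) (τ : ℝ) (v : centred K) : ENNReal :=
  gmrfWeight L τ v / ∫⁻ w, gmrfWeight L τ w ∂(centredLebesgue K)

/-- The parameters `((τ_q, θ), (τ_C, φ))` of the hierarchy: `θ` is the log-odds vector of the
target class prior and `φ i` that of the `i`-th column of the confusion matrix. -/
abbrev Param (K : ℕ) : Type := (ℝ × centred K) × (ℝ × (Fin K → centred K))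

/-- The target class prior `q = softmax θ`. -/
def Param.q {K : ℕ} (x : Param K) : Fin K → ℝ :=
  softmax (x.1.2 : EuclideanSpace ℝ (Fin K))

/-- The confusion matrix, with `i`-th column `softmax (φ i)`. -/
def Param.conf {K : ℕ} (x : Param K) : Matrix (Fin K) (Fin K) ℝ :=
  Matrix.of fun j i => softmax (x.2.2 i : EuclideanSpace ℝ (Fin K)) j

/-- The joint prior: `τ_q ∼ πq` and `τ_C ∼ πC` are independent; given them, `θ` is a Gaussian
Markov random field with precision `τ_q L`, the `φ i` are Gaussian Markov random fields with
precision `τ_C L`, and all these are independent. -/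
def prior {K : ℕ} (L : Matrix (Fin K) (Fin K) ℝ) (πq πC : Measure ℝ) : Measure (Param K) :=
  ((πq.prod (centredLebesgue K)).prod
      (πC.prod (Measure.pi fun _ : Fin K => centredLebesgue K))).withDensity
    fun x => gmrfDensity L x.1.1 x.1.2 * ∏ i, gmrfDensity L x.2.1 (x.2.2 i)

/-- The prior reweighted by the likelihood of the data. -/
def unnormalizedPosterior {K : ℕ} (L : Matrix (Fin K) (Fin K) ℝ) (πq πC : Measure ℝ)
    (nS : Fin K → ℕ) (nT : ℕ) (d : Data K) : Measure (Param K) :=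
  (prior L πq πC).withDensity fun x => ENNReal.ofReal (likelihood nS nT x.q x.conf d)

/-- The joint posterior (Bayes' rule). -/
def posterior {K : ℕ} (L : Matrix (Fin K) (Fin K) ℝ) (πq πC : Measure ℝ)
    (nS : Fin K → ℕ) (nT : ℕ) (d : Data K) : Measure (Param K) :=
  (unnormalizedPosterior L πq πC nS nT d Set.univ)⁻¹ • unnormalizedPosterior L πq πC nS nT d

/-- The posterior variance of the class prior `q i`. -/
def posteriorVar {K : ℕ} (L : Matrix (Fin K) (Fin K) ℝ) (πq πC : Measure ℝ)
    (nS : Fin K → ℕ) (nT : ℕ) (d : Data K) (i : Fin K) : ℝ :=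
  variance (fun x : Param K => x.q i) (posterior L πq πC nS nT d)

/-- The hyper-prior of `τ_q`: a fixed positive value, or a Gamma law. -/
def IsFixedOrGamma (π : Measure ℝ) : Prop :=
  (∃ τ : ℝ, 0 < τ ∧ π = Measure.dirac τ) ∨
    ∃ a b : ℝ, 0 < a ∧ 0 < b ∧ π = gammaMeasure a b

end

end GSBBSE

/-!
For data in the support of the data law, the likelihood is a constant times `exp (-D)`, where `D`
is the sum over the samples of size times relative entropy between the observed frequencies `f`
and the cell probabilities of the parameter. As `C₀` is invertible, the map from log-odds to cell
probabilities is a bi-Lipschitz chart near the truth. Contracting in this chart halfway towards `f`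
at least halves `D` near the truth, because relative entropy is convex, while volume shrinks by a
factor depending only on the chart; the prior density is almost constant there, and parameters far
from `f` are exponentially unlikely. Hence the posterior expectation of `D` is bounded by a constant
depending only on the truth, as soon as `f` is close to the truth and `N` is large. Since `D` is at
least a multiple of `ρ * N` times the squared distance of the cell probabilities to `f`, and the
class prior is a Lipschitz function of the cell probabilities, the posterior variance is
`O(1 / (ρ * N))`. Multinomial tail bounds put `f` near the truth with probability tending to one,
and `lambda2 L ≤ 2 * K` because the weights are at most one.
-/

namespace GSBBSE

open Metric Set
open scoped NNReal ENNReal Topology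

/-! ### Relative entropy -/

/-- The relative entropy of `f` with respect to `p`; a cell with `f j = 0` contributes `0`. -/
noncomputable def relEnt {ι : Type*} [Fintype ι] (f p : ι → ℝ) : ℝ :=
  ∑ j, f j * Real.log (f j / p j)

lemma sq_sqrt_sub_sqrt_le {f p : ℝ} (hf : 0 ≤ f) (hp : 0 < p) :
    (√f - √p) ^ 2 ≤ f * Real.log (f / p) - f + p := by
  obtain rfl | hf := hf.eq_or_lt
  · simp [Real.sq_sqrt hp.le]
  have hlog : Real.log (f / p) = -2 * Real.log (√p / √f) := by
    rw [← Real.sqrt_div' _ hf.le, Real.log_sqrt (by positivity), ← inv_div f p, Real.log_inv]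
    ring
  have hmul : f * Real.log (√p / √f) ≤ √f * √p - f := by
    calc f * Real.log (√p / √f) ≤ f * (√p / √f - 1) := by
          gcongr
          exact Real.log_le_sub_one_of_pos (by positivity)
      _ = √f * √p - f := by
          have h : f / √f = √f := Real.div_sqrt
          rw [mul_sub, mul_one, mul_div_left_comm, h, mul_comm]
  rw [hlog, sub_sq, Real.sq_sqrt hf.le, Real.sq_sqrt hp.le]
  linarith

lemma sq_sub_le_mul_log_div {f p : ℝ} (hf : 0 ≤ f) (hf1 : f ≤ 1) (hp : 0 < p) (hp1 : p ≤ 1) :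
    (f - p) ^ 2 ≤ 4 * (f * Real.log (f / p) - f + p) := by
  have hadd : √f + √p ≤ 2 := by linarith [Real.sqrt_le_one.2 hf1, Real.sqrt_le_one.2 hp1]
  calc (f - p) ^ 2 = (√f + √p) ^ 2 * (√f - √p) ^ 2 := by
        rw [← mul_pow, ← sq_sub_sq, Real.sq_sqrt hf, Real.sq_sqrt hp.le]
    _ ≤ 2 ^ 2 * (√f - √p) ^ 2 := by gcongr
    _ ≤ 4 * (f * Real.log (f / p) - f + p) := by
        linarith [sq_sqrt_sub_sqrt_le hf hp]

section relEnt

variable {ι : Type*} [Fintype ι] {f p : ι → ℝ}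

lemma sum_sq_sub_le_relEnt (hf : f ∈ stdSimplex ℝ ι) (hp : p ∈ stdSimplex ℝ ι)
    (hp0 : ∀ j, 0 < p j) : ∑ j, (f j - p j) ^ 2 ≤ 4 * relEnt f p :=
  calc ∑ j, (f j - p j) ^ 2 ≤ ∑ j, 4 * (f j * Real.log (f j / p j) - f j + p j) :=
        Finset.sum_le_sum fun j _ => sq_sub_le_mul_log_div (hf.1 j)
          (mem_Icc_of_mem_stdSimplex hf j).2 (hp0 j) (mem_Icc_of_mem_stdSimplex hp j).2
    _ = 4 * relEnt f p := by
        rw [← Finset.mul_sum, Finset.sum_add_distrib, Finset.sum_sub_distrib, hf.2, hp.2,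
          sub_add_cancel, relEnt]

lemma sq_norm_sub_le_relEnt (hf : f ∈ stdSimplex ℝ ι) (hp : p ∈ stdSimplex ℝ ι)
    (hp0 : ∀ j, 0 < p j) : ‖p - f‖ ^ 2 ≤ 4 * relEnt f p := by
  have hsum := sum_sq_sub_le_relEnt hf hp hp0
  have hnonneg : 0 ≤ 4 * relEnt f p := (Finset.sum_nonneg fun _ _ => sq_nonneg _).trans hsum
  refine (Real.le_sqrt (norm_nonneg _) hnonneg).1 ((pi_norm_le_iff_of_nonneg
    (Real.sqrt_nonneg _)).2 fun j => Real.abs_le_sqrt ?_)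
  rw [Pi.sub_apply, ← neg_sq, neg_sub]
  exact (Finset.single_le_sum (f := fun j => (f j - p j) ^ 2) (fun _ _ => sq_nonneg _)
    (Finset.mem_univ j)).trans hsum

lemma relEnt_nonneg (hf : f ∈ stdSimplex ℝ ι) (hp : p ∈ stdSimplex ℝ ι) (hp0 : ∀ j, 0 < p j) :
    0 ≤ relEnt f p := by
  linarith [sq_nonneg ‖p - f‖, sq_norm_sub_le_relEnt hf hp hp0]

lemma two_mul_log_div_midpoint_le {f p : ℝ} (hf : 0 < f) (hp : 0 < p) :
    2 * Real.log (f / midpoint ℝ p f) ≤ Real.log (f / p) := by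
  have hmid : midpoint ℝ p f = (p + f) / 2 := by
    rw [midpoint_eq_smul_add, smul_eq_mul, invOf_eq_inv]
    ring
  rw [hmid, ← Real.log_rpow (by positivity)]
  refine Real.log_le_log (by positivity) ?_
  rw [Real.rpow_two, div_pow, div_le_div_iff₀ (by positivity) hp]
  nlinarith [mul_nonneg hf.le (sq_nonneg (p - f))]

lemma two_mul_relEnt_midpoint_le (hf : ∀ j, 0 ≤ f j) (hp : ∀ j, 0 < p j) :
    2 * relEnt f (midpoint ℝ p f) ≤ relEnt f p := by
  rw [relEnt, relEnt, Finset.mul_sum]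
  refine Finset.sum_le_sum fun j _ => ?_
  rw [pi_midpoint_apply, mul_left_comm]
  obtain hfj | hfj := (hf j).eq_or_lt
  · simp [← hfj]
  · exact mul_le_mul_of_nonneg_left (two_mul_log_div_midpoint_le hfj (hp j)) hfj.le

lemma relEnt_eq_sum_sub (hp : ∀ j, p j ≠ 0) :
    relEnt f p = ∑ j, (f j * Real.log (f j) - f j * Real.log (p j)) := by
  refine Finset.sum_congr rfl fun j _ => ?_
  obtain hfj | hfj := eq_or_ne (f j) 0
  · simp [hfj]
  · rw [Real.log_div hfj (hp j), mul_sub]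

lemma continuousAt_relEnt (hp : ∀ j, p j ≠ 0) :
    ContinuousAt (fun x : (ι → ℝ) × (ι → ℝ) => relEnt x.1 x.2) (f, p) := by
  have hev : ∀ᶠ x : (ι → ℝ) × (ι → ℝ) in 𝓝 (f, p), ∀ j, x.2 j ≠ 0 :=
    Filter.eventually_all.2 fun j =>
      ((continuous_apply j).comp continuous_snd).continuousAt.eventually_ne (hp j)
  refine ContinuousAt.congr ?_ (hev.mono fun x hx => (relEnt_eq_sum_sub hx).symm)
  refine tendsto_finsetSum _ fun j _ => ?_
  have hfst : ContinuousAt (fun x : (ι → ℝ) × (ι → ℝ) => x.1 j) (f, p) := by fun_prop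
  have hsnd : ContinuousAt (fun x : (ι → ℝ) × (ι → ℝ) => x.2 j) (f, p) := by fun_prop
  exact (Real.continuous_mul_log.continuousAt.comp hfst).sub (hfst.mul (hsnd.log (hp j)))

@[fun_prop]
lemma measurable_relEnt (f : ι → ℝ) : Measurable (relEnt f) := by
  unfold relEnt
  fun_prop

lemma relEnt_self (f : ι → ℝ) : relEnt f f = 0 :=
  Finset.sum_eq_zero fun j _ => by
    obtain hfj | hfj := eq_or_ne (f j) 0 <;> simp [hfj]

end relEnt

/-! ### Multinomial tails -/

section multinomial

variable {K n : ℕ} {p : Fin K → ℝ} {k : Fin K → ℕ}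

lemma multinomialProb_nonneg (hp : ∀ j, 0 ≤ p j) (k : Fin K → ℕ) :
    0 ≤ multinomialProb n p k := by
  unfold multinomialProb
  split_ifs
  · exact mul_nonneg (Nat.cast_nonneg _) (Finset.prod_nonneg fun j _ => pow_nonneg (hp j) _)
  · exact le_rfl

lemma multinomialProb_pos (hk : ∑ j, k j = n) (hp : ∀ j, k j ≠ 0 → 0 < p j) :
    0 < multinomialProb n p k := by
  rw [multinomialProb, if_pos hk]
  refine mul_pos (Nat.cast_pos.2 (Nat.multinomial_pos _ _)) (Finset.prod_pos fun j _ => ?_)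
  obtain hkj | hkj := eq_or_ne (k j) 0
  · simp [hkj]
  · exact pow_pos (hp j hkj) _

lemma multinomialProb_eq_mul_exp_relEnt {f : Fin K → ℝ} (hp : ∀ j, 0 < p j)
    (hf : ∀ j, 0 ≤ f j) (hk : ∀ j, (k j : ℝ) = n * f j) :
    multinomialProb n p k = multinomialProb n f k * Real.exp (-(n * relEnt f p)) := by
  have hpow (j : Fin K) :
      p j ^ k j = f j ^ k j * Real.exp (-(n * (f j * Real.log (f j / p j)))) := by
    rw [← mul_assoc, ← hk j]
    obtain hfj | hfj := (hf j).eq_or_lt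
    · have hkj : k j = 0 := Nat.cast_eq_zero.1 (by rw [hk j, ← hfj, mul_zero])
      simp [hkj]
    · rw [← mul_neg, ← Real.log_inv, inv_div, Real.exp_nat_mul,
        Real.exp_log (div_pos (hp j) hfj), ← mul_pow, mul_div_cancel₀ _ hfj.ne']
  unfold multinomialProb
  split_ifs
  · rw [relEnt, Finset.mul_sum, ← Finset.sum_neg_distrib, Real.exp_sum, mul_assoc,
      ← Finset.prod_mul_distrib, Finset.prod_congr rfl fun j _ => hpow j]
  · simp

lemma sum_multinomialProb_mul_prod_pow (n : ℕ) (p s : Fin K → ℝ) :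
    ∑ k ∈ Finset.piAntidiag Finset.univ n, multinomialProb n p k * ∏ j, s j ^ k j =
      (∑ j, p j * s j) ^ n := by
  rw [Finset.sum_pow_eq_sum_piAntidiag]
  refine Finset.sum_congr rfl fun k hk => ?_
  rw [multinomialProb, if_pos (Finset.mem_piAntidiag.1 hk).1, mul_assoc, ← Finset.prod_mul_distrib]
  simp only [mul_pow]

lemma sum_multinomialProb (hp : ∑ j, p j = 1) :
    ∑ k ∈ Finset.piAntidiag Finset.univ n, multinomialProb n p k = 1 := by
  simpa [hp] using sum_multinomialProb_mul_prod_pow n p 1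

lemma sum_multinomialProb_mul_exp_le (hp : p ∈ stdSimplex ℝ (Fin K)) {g : Fin K → ℝ} {u : ℝ}
    (hu : u ≤ 1) (hg : ∀ j, |g j| ≤ u) (hmean : ∑ j, p j * g j = 0) :
    ∑ k ∈ Finset.piAntidiag Finset.univ n, multinomialProb n p k * Real.exp (∑ j, k j * g j) ≤
      Real.exp (n * u ^ 2) := by
  have hexp (j : Fin K) : Real.exp (g j) ≤ 1 + g j + u ^ 2 := by
    have hsq : g j ^ 2 ≤ u ^ 2 := sq_le_sq.2 ((hg j).trans (le_abs_self u))
    linarith [(abs_le.1 (Real.abs_exp_sub_one_sub_id_le ((hg j).trans hu))).2]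
  have hmgf : ∑ j, p j * Real.exp (g j) ≤ Real.exp (u ^ 2) :=
    calc ∑ j, p j * Real.exp (g j) ≤ ∑ j, (p j + p j * g j + p j * u ^ 2) := by
          refine Finset.sum_le_sum fun j _ => ?_
          linarith [mul_le_mul_of_nonneg_left (hexp j) (hp.1 j)]
      _ = u ^ 2 + 1 := by
          rw [Finset.sum_add_distrib, Finset.sum_add_distrib, ← Finset.sum_mul, hp.2, hmean]
          ring
      _ ≤ Real.exp (u ^ 2) := Real.add_one_le_exp _
  calc ∑ k ∈ Finset.piAntidiag Finset.univ n, multinomialProb n p k * Real.exp (∑ j, k j * g j)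
      = (∑ j, p j * Real.exp (g j)) ^ n := by
        simp only [Real.exp_sum, Real.exp_nat_mul, sum_multinomialProb_mul_prod_pow]
    _ ≤ Real.exp (u ^ 2) ^ n := by
        gcongr
        exact Finset.sum_nonneg fun j _ => mul_nonneg (hp.1 j) (Real.exp_nonneg _)
    _ = Real.exp (n * u ^ 2) := (Real.exp_nat_mul _ n).symm

-- The exponent is tilted by `ε / 2`, the minimiser of `u ↦ u ^ 2 - u * ε`.
lemma sum_multinomialProb_upper_tail_le (hp : p ∈ stdSimplex ℝ (Fin K)) {h : Fin K → ℝ}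
    (hh : ∀ j, |h j| ≤ 1) (hmean : ∑ j, p j * h j = 0) {ε : ℝ} (hε : 0 ≤ ε) (hε2 : ε ≤ 2) :
    ∑ k ∈ Finset.piAntidiag Finset.univ n with ε * n ≤ ∑ j, k j * h j, multinomialProb n p k ≤
      Real.exp (-(n * ε ^ 2 / 4)) := by
  have hmgf := sum_multinomialProb_mul_exp_le (n := n) hp (g := fun j => ε / 2 * h j)
    (u := ε / 2) (by linarith)
    (fun j => by
      rw [abs_mul, abs_of_nonneg (by positivity)]
      exact mul_le_of_le_one_right (by positivity) (hh j))
    (by simp only [mul_left_comm (p _), ← Finset.mul_sum, hmean, mul_zero])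
  simp only [mul_left_comm _ (ε / 2), ← Finset.mul_sum] at hmgf
  calc ∑ k ∈ Finset.piAntidiag Finset.univ n with ε * n ≤ ∑ j, k j * h j, multinomialProb n p k
      ≤ ∑ k ∈ Finset.piAntidiag Finset.univ n with ε * n ≤ ∑ j, k j * h j,
          multinomialProb n p k * Real.exp (ε / 2 * ∑ j, k j * h j) *
            Real.exp (-(n * ε ^ 2 / 2)) := by
        refine Finset.sum_le_sum fun k hk => ?_
        rw [mul_assoc, ← Real.exp_add]
        refine le_mul_of_one_le_right (multinomialProb_nonneg hp.1 k) (Real.one_le_exp ?_)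
        linarith [mul_le_mul_of_nonneg_left (Finset.mem_filter.1 hk).2 (div_nonneg hε zero_le_two)]
    _ ≤ Real.exp (n * (ε / 2) ^ 2) * Real.exp (-(n * ε ^ 2 / 2)) := by
        rw [← Finset.sum_mul]
        gcongr
        refine (Finset.sum_le_sum_of_subset_of_nonneg (Finset.filter_subset _ _)
          fun k _ _ => ?_).trans hmgf
        exact mul_nonneg (multinomialProb_nonneg hp.1 k) (Real.exp_nonneg _)
    _ = Real.exp (-(n * ε ^ 2 / 4)) := by
        rw [← Real.exp_add]
        ring_nf

lemma sum_multinomialProb_two_sided_tail_le (hp : p ∈ stdSimplex ℝ (Fin K)) {h : Fin K → ℝ}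
    (hh : ∀ j, |h j| ≤ 1) (hmean : ∑ j, p j * h j = 0) {ε : ℝ} (hε : 0 ≤ ε) (hε2 : ε ≤ 2) :
    ∑ k ∈ Finset.piAntidiag Finset.univ n with ε * n ≤ |∑ j, k j * h j|, multinomialProb n p k ≤
      2 * Real.exp (-(n * ε ^ 2 / 4)) := by
  have hneg := sum_multinomialProb_upper_tail_le (n := n) hp (h := -h) (by simpa using hh)
    (by simpa using hmean) hε hε2
  have hpos := sum_multinomialProb_upper_tail_le (n := n) hp hh hmean hε hε2
  simp only [Pi.neg_apply, mul_neg, Finset.sum_neg_distrib] at hneg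
  simp only [le_abs, Finset.filter_or]
  refine (le_add_of_nonneg_right ?_).trans ((Finset.sum_union_inter ..).trans_le
    ((add_le_add hpos hneg).trans_eq (two_mul _).symm))
  exact Finset.sum_nonneg fun k _ => multinomialProb_nonneg hp.1 k

lemma sum_multinomialProb_deviation_le (hp : p ∈ stdSimplex ℝ (Fin K)) (j : Fin K) {ε : ℝ}
    (hε : 0 ≤ ε) (hε2 : ε ≤ 2) :
    ∑ k ∈ Finset.piAntidiag Finset.univ n with ε * n ≤ |k j - n * p j|, multinomialProb n p k ≤
      2 * Real.exp (-(n * ε ^ 2 / 4)) := by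
  have hpj := mem_Icc_of_mem_stdSimplex hp j
  refine (Finset.sum_congr (Finset.filter_congr fun k hk => ?_) fun _ _ => rfl).trans_le
    (sum_multinomialProb_two_sided_tail_le hp (h := fun i => (if i = j then 1 else 0) - p j)
      (fun i => ?_) ?_ hε hε2)
  · have hkn : ∑ i, (k i : ℝ) = n := by exact_mod_cast (Finset.mem_piAntidiag.1 hk).1
    simp [mul_sub, Finset.sum_sub_distrib, ← Finset.sum_mul, hkn]
  · rw [abs_le]
    split_ifs <;> constructor <;> linarith [hpj.1, hpj.2]
  · simp [mul_sub, Finset.sum_sub_distrib, ← Finset.sum_mul, hp.2]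

end multinomial

/-! ### The law of the data -/

/-- The cell probabilities of the target sample (`none`) and of the source samples (`some i`). -/
noncomputable def cells {K : ℕ} (q : Fin K → ℝ) (C : Matrix (Fin K) (Fin K) ℝ) :
    Option (Fin K) → Fin K → ℝ
  | none => C.mulVec q
  | some i => fun j => C j i

/-- The sizes of all samples, indexed as in `cells`. -/
def sizes {K : ℕ} (nS : Fin K → ℕ) (nT : ℕ) : Option (Fin K) → ℕ
  | none => nT
  | some i => nS i

/-- The count vectors of all samples, indexed as in `cells`. -/
def counts {K : ℕ} (d : Data K) : Option (Fin K) → Fin K → ℕ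
  | none => d.2
  | some i => d.1 i

/-- The empirical cell frequencies of all samples, indexed as in `cells`; those of an empty sample
are `0`. -/
noncomputable def frequencies {K : ℕ} (nS : Fin K → ℕ) (nT : ℕ) (d : Data K) :
    Option (Fin K) → Fin K → ℝ :=
  fun o j => counts d o j / sizes nS nT o

/-- The data sets with the prescribed sample sizes. -/
def dataSupport {K : ℕ} (nS : Fin K → ℕ) (nT : ℕ) : Finset (Data K) :=
  (Fintype.piFinset fun i => Finset.piAntidiag Finset.univ (nS i)) ×ˢ
    Finset.piAntidiag Finset.univ nT

section data

variable {K : ℕ} {nS : Fin K → ℕ} {nT : ℕ} {q : Fin K → ℝ} {C : Matrix (Fin K) (Fin K) ℝ}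
  {d : Data K}

lemma sum_sizes (nS : Fin K → ℕ) (nT : ℕ) : ∑ o, sizes nS nT o = nT + ∑ i, nS i :=
  Fintype.sum_option _

lemma mem_dataSupport : d ∈ dataSupport nS nT ↔ ∀ o, ∑ j, counts d o j = sizes nS nT o := by
  simp [dataSupport, counts, sizes, Option.forall, and_comm]

lemma frequencies_mem_stdSimplex (hd : d ∈ dataSupport nS nT) {o : Option (Fin K)}
    (ho : sizes nS nT o ≠ 0) : frequencies nS nT d o ∈ stdSimplex ℝ (Fin K) := by
  refine ⟨fun j => by unfold frequencies; positivity, ?_⟩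
  simp only [frequencies]
  rw [← Finset.sum_div, ← Nat.cast_sum, mem_dataSupport.1 hd, div_self (Nat.cast_ne_zero.2 ho)]

lemma likelihood_eq_prod (nS : Fin K → ℕ) (nT : ℕ) (q : Fin K → ℝ)
    (C : Matrix (Fin K) (Fin K) ℝ) (d : Data K) :
    likelihood nS nT q C d = ∏ o, multinomialProb (sizes nS nT o) (cells q C o) (counts d o) := by
  rw [Fintype.prod_option, likelihood, mul_comm]
  rfl

lemma likelihood_nonneg (hz : ∀ o j, 0 ≤ cells q C o j) (d : Data K) :
    0 ≤ likelihood nS nT q C d := by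
  rw [likelihood_eq_prod]
  exact Finset.prod_nonneg fun o _ => multinomialProb_nonneg (hz o) _

lemma likelihood_eq_zero_of_notMem (hd : d ∉ dataSupport nS nT) : likelihood nS nT q C d = 0 := by
  rw [mem_dataSupport, not_forall] at hd
  obtain ⟨o, ho⟩ := hd
  rw [likelihood_eq_prod]
  exact Finset.prod_eq_zero (Finset.mem_univ o) (if_neg ho)

lemma sum_dataSupport_prod (nS : Fin K → ℕ) (nT : ℕ) (g : Option (Fin K) → (Fin K → ℕ) → ℝ) :
    ∑ d ∈ dataSupport nS nT, ∏ o, g o (counts d o) =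
      ∏ o, ∑ k ∈ Finset.piAntidiag Finset.univ (sizes nS nT o), g o k := by
  simp only [dataSupport, Fintype.prod_option, Finset.sum_product, counts, sizes]
  rw [Finset.prod_univ_sum, mul_comm, Finset.sum_mul_sum]
  simp only [mul_comm]

lemma sum_likelihood_marginal (hz : ∀ o, ∑ j, cells q C o j = 1) (o : Option (Fin K))
    (P : (Fin K → ℕ) → Prop) [DecidablePred P] :
    ∑ d ∈ dataSupport nS nT with P (counts d o), likelihood nS nT q C d =
      ∑ k ∈ Finset.piAntidiag Finset.univ (sizes nS nT o) with P k,
        multinomialProb (sizes nS nT o) (cells q C o) k := by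
  have hfactor (d : Data K) : (if P (counts d o) then likelihood nS nT q C d else 0) =
      ∏ o', multinomialProb (sizes nS nT o') (cells q C o') (counts d o') *
        (if o' = o then if P (counts d o') then 1 else 0 else 1) := by
    rw [Finset.prod_mul_distrib, Finset.prod_ite_eq', if_pos (Finset.mem_univ o), mul_ite, mul_one,
      mul_zero, likelihood_eq_prod]
  rw [Finset.sum_filter, Finset.sum_congr rfl fun d _ => hfactor d, sum_dataSupport_prod nS nT
      fun o' k => multinomialProb (sizes nS nT o') (cells q C o') k *
        (if o' = o then if P k then 1 else 0 else 1),
    Finset.prod_eq_single o (fun o' _ ho' => by simp [ho', sum_multinomialProb (hz o')]) (by simp)]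
  simp [Finset.sum_filter]

lemma sum_likelihood (hz : ∀ o, ∑ j, cells q C o j = 1) :
    ∑ d ∈ dataSupport nS nT, likelihood nS nT q C d = 1 := by
  simp only [likelihood_eq_prod]
  rw [sum_dataSupport_prod nS nT fun o => multinomialProb (sizes nS nT o) (cells q C o)]
  exact Finset.prod_eq_one fun o _ => sum_multinomialProb (hz o)

lemma dataLaw_real (hz : ∀ o j, 0 ≤ cells q C o j) (s : Set (Data K)) [DecidablePred (· ∈ s)] :
    (dataLaw nS nT q C).real s = ∑ d ∈ dataSupport nS nT with d ∈ s, likelihood nS nT q C d := by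
  have hs : MeasurableSet s := s.to_countable.measurableSet
  rw [Measure.real, dataLaw, withDensity_apply _ hs, ← lintegral_indicator hs, lintegral_count,
    tsum_eq_sum (s := dataSupport nS nT) fun d hd => by
      simp [indicator_apply, likelihood_eq_zero_of_notMem hd], Finset.sum_filter,
    ENNReal.toReal_sum fun d _ => by rw [indicator_apply]; split_ifs <;> simp]
  refine Finset.sum_congr rfl fun d _ => ?_
  simp only [indicator_apply]
  split_ifs <;> simp [likelihood_nonneg hz]

lemma isProbabilityMeasure_dataLaw (hz : ∀ o, cells q C o ∈ stdSimplex ℝ (Fin K)) :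
    IsProbabilityMeasure (dataLaw nS nT q C) := by
  classical
  refine ⟨?_⟩
  have h : (dataLaw nS nT q C).real univ = 1 := by
    rw [dataLaw_real fun o => (hz o).1]
    simpa using sum_likelihood fun o => (hz o).2
  exact (ENNReal.toReal_eq_one_iff _).1 h

lemma dataLaw_real_compl_dataSupport (hz : ∀ o j, 0 ≤ cells q C o j) :
    (dataLaw nS nT q C).real {d | d ∉ dataSupport nS nT} = 0 := by
  classical
  rw [dataLaw_real hz]
  exact Finset.sum_eq_zero fun d hd => absurd (Finset.mem_filter.1 hd).1 (Finset.mem_filter.1 hd).2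

lemma dataLaw_real_deviation_le (hz : ∀ o, cells q C o ∈ stdSimplex ℝ (Fin K))
    (o : Option (Fin K)) (j : Fin K) {ε : ℝ} (hε : 0 ≤ ε) (hε2 : ε ≤ 2) :
    (dataLaw nS nT q C).real
        {d | ε * sizes nS nT o ≤ |counts d o j - sizes nS nT o * cells q C o j|} ≤
      2 * Real.exp (-(sizes nS nT o * ε ^ 2 / 4)) := by
  classical
  rw [dataLaw_real fun o => (hz o).1]
  exact (sum_likelihood_marginal (fun o => (hz o).2) o fun k =>
      ε * sizes nS nT o ≤ |k j - sizes nS nT o * cells q C o j|).trans_le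
    (sum_multinomialProb_deviation_le (hz o) j hε hε2)

lemma dist_frequencies_lt {z : Option (Fin K) → Fin K → ℝ} {ε : ℝ} (hε : 0 < ε)
    (h : ∀ o j, |counts d o j - sizes nS nT o * z o j| < ε * sizes nS nT o) :
    dist (frequencies nS nT d) z < ε := by
  refine (dist_pi_lt_iff hε).2 fun o => (dist_pi_lt_iff hε).2 fun j => ?_
  have hn : (0 : ℝ) < sizes nS nT o :=
    pos_of_mul_pos_right ((abs_nonneg _).trans_lt (h o j)) hε.le
  rw [Real.dist_eq, frequencies, div_sub' hn.ne', abs_div, abs_of_pos hn, div_lt_iff₀ hn]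
  exact h o j

lemma dataLaw_real_ge_of_dist_frequencies_lt (hz : ∀ o, cells q C o ∈ stdSimplex ℝ (Fin K))
    {ε : ℝ} (hε : 0 < ε) (hε2 : ε ≤ 2) {m : ℝ} (hm : ∀ o, m ≤ sizes nS nT o) {s : Set (Data K)}
    (hs : ∀ d ∈ dataSupport nS nT, dist (frequencies nS nT d) (cells q C) < ε → d ∈ s) :
    1 - (K + 1) * K * (2 * Real.exp (-(m * ε ^ 2 / 4))) ≤ (dataLaw nS nT q C).real s := by
  have := isProbabilityMeasure_dataLaw (nS := nS) (nT := nT) hz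
  have hcompl : sᶜ ⊆ {d | d ∉ dataSupport nS nT} ∪
      ⋃ o, ⋃ j, {d | ε * sizes nS nT o ≤ |counts d o j - sizes nS nT o * cells q C o j|} := by
    intro d hd
    by_contra! hgood
    simp only [mem_union, mem_ofPred_eq, mem_iUnion, not_or, not_not, not_exists, not_le] at hgood
    exact hd (hs d hgood.1 (dist_frequencies_lt hε hgood.2))
  have hbad : (dataLaw nS nT q C).real sᶜ ≤ (K + 1) * K * (2 * Real.exp (-(m * ε ^ 2 / 4))) := by
    refine (measureReal_mono hcompl).trans ((measureReal_union_le _ _).trans ?_)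
    rw [dataLaw_real_compl_dataSupport fun o => (hz o).1, zero_add]
    calc _ ≤ ∑ _o : Option (Fin K), ∑ _j : Fin K, 2 * Real.exp (-(m * ε ^ 2 / 4)) := by
          refine (measureReal_iUnion_fintype_le _).trans (Finset.sum_le_sum fun o _ => ?_)
          refine (measureReal_iUnion_fintype_le _).trans (Finset.sum_le_sum fun j _ => ?_)
          refine (dataLaw_real_deviation_le hz o j hε.le hε2).trans ?_
          have := hm o
          gcongr
      _ = _ := by simp [mul_assoc]
  rw [probReal_compl_eq_one_sub s.to_countable.measurableSet] at hbad
  linarith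

lemma tendsto_mul_exp_neg_mul_natCast (a : ℝ) {b : ℝ} (hb : 0 < b) :
    Filter.Tendsto (fun N : ℕ => a * Real.exp (-(b * N))) Filter.atTop (𝓝 0) := by
  have hlin : Filter.Tendsto (fun N : ℕ => b * (N : ℝ)) Filter.atTop Filter.atTop :=
    tendsto_natCast_atTop_atTop.const_mul_atTop hb
  simpa only [mul_zero, Function.comp_def] using
    (Real.tendsto_exp_neg_atTop_nhds_zero.comp hlin).const_mul a

lemma exists_dataLaw_real_ge_of_dist_frequencies_lt
    (hz : ∀ o, cells q C o ∈ stdSimplex ℝ (Fin K)) {ε ρ δ : ℝ} (hε : 0 < ε) (hρ : 0 < ρ)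
    (hδ : 0 < δ) :
    ∃ N₀ : ℕ, ∀ (nS : Fin K → ℕ) (nT : ℕ), N₀ ≤ ∑ o, sizes nS nT o →
      (∀ o, ρ * ∑ o, (sizes nS nT o : ℝ) ≤ sizes nS nT o) → ∀ s : Set (Data K),
      (∀ d ∈ dataSupport nS nT, dist (frequencies nS nT d) (cells q C) < ε → d ∈ s) →
        1 - δ ≤ (dataLaw nS nT q C).real s := by
  have hε' : 0 < min ε 2 := lt_min hε two_pos
  obtain ⟨N₀, hN₀⟩ := Filter.eventually_atTop.1 ((tendsto_mul_exp_neg_mul_natCast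
    ((K + 1) * K * 2) (show 0 < ρ * min ε 2 ^ 2 / 4 by positivity)).eventually_le_const hδ)
  refine ⟨N₀, fun nS nT hN hρN s hs => ?_⟩
  have hlaw := dataLaw_real_ge_of_dist_frequencies_lt hz hε' (min_le_right _ _) hρN
    fun d hd hfreq => hs d hd (hfreq.trans_le (min_le_left _ _))
  have hbound := hN₀ _ hN
  rw [Nat.cast_sum, div_mul_eq_mul_div, mul_right_comm ρ] at hbound
  linarith

end data

/-! ### The softmax parametrisation -/

section softmax

variable {K : ℕ}

lemma softmax_pos (v : EuclideanSpace ℝ (Fin K)) (i : Fin K) : 0 < softmax v i :=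
  div_pos (Real.exp_pos _) (Finset.sum_pos (fun _ _ => Real.exp_pos _) ⟨i, Finset.mem_univ i⟩)

lemma sum_exp_pos [NeZero K] (v : EuclideanSpace ℝ (Fin K)) : 0 < ∑ j, Real.exp (v j) :=
  Finset.sum_pos (fun _ _ => Real.exp_pos _) Finset.univ_nonempty

lemma softmax_mem_stdSimplex [NeZero K] (v : EuclideanSpace ℝ (Fin K)) :
    softmax v ∈ stdSimplex ℝ (Fin K) := by
  refine ⟨fun i => (softmax_pos v i).le, ?_⟩
  unfold softmax
  rw [← Finset.sum_div, div_self (sum_exp_pos v).ne']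

lemma contDiff_softmax [NeZero K] : ContDiff ℝ 1 fun v : EuclideanSpace ℝ (Fin K) => softmax v := by
  refine contDiff_pi.2 fun i => ?_
  have hexp (j : Fin K) : ContDiff ℝ 1 fun v : EuclideanSpace ℝ (Fin K) => Real.exp (v j) :=
    (EuclideanSpace.proj j : EuclideanSpace ℝ (Fin K) →L[ℝ] ℝ).contDiff.exp
  exact (hexp i).div (ContDiff.sum fun j _ => hexp j) fun v => (sum_exp_pos v).ne'

/-- The orthogonal projection of `ℝ^K` to the centred vectors. -/
noncomputable def centre (K : ℕ) : (Fin K → ℝ) →ₗ[ℝ] centred K where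
  toFun v := ⟨WithLp.toLp 2 fun i => v i - (∑ j, v j) / K, by
    change ∑ i, (v i - (∑ j, v j) / K) = 0
    obtain rfl | hK := eq_or_ne K 0
    · simp
    · simp [Finset.sum_sub_distrib, mul_div_cancel₀ _ (Nat.cast_ne_zero.2 hK : (K : ℝ) ≠ 0)]⟩
  map_add' v w := by
    ext i
    simp only [Pi.add_apply, Finset.sum_add_distrib, Submodule.coe_add, PiLp.add_apply]
    ring
  map_smul' c v := by
    ext i
    simp only [Pi.smul_apply, smul_eq_mul, ← Finset.mul_sum, RingHom.id_apply,
      Submodule.coe_smul, PiLp.smul_apply]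
    ring

lemma centre_apply (v : Fin K → ℝ) (i : Fin K) :
    (centre K v : EuclideanSpace ℝ (Fin K)) i = v i - (∑ j, v j) / K := rfl

/-- The centred log-odds of a probability vector with positive entries: the inverse of `softmax`
on the centred vectors. -/
noncomputable def centredLog (p : Fin K → ℝ) : centred K :=
  centre K fun i => Real.log (p i)

lemma softmax_centredLog {p : Fin K → ℝ} (hp : ∀ i, 0 < p i) (hp1 : ∑ i, p i = 1) :
    softmax (centredLog p : EuclideanSpace ℝ (Fin K)) = p := by
  ext i
  simp only [softmax, centredLog, centre_apply, Real.exp_sub, Real.exp_log (hp _)]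
  rw [← Finset.sum_div, hp1]
  field_simp

lemma centredLog_softmax [NeZero K] (v : centred K) :
    centredLog (softmax (v : EuclideanSpace ℝ (Fin K))) = v := by
  ext i
  have hv : ∑ j, (v : EuclideanSpace ℝ (Fin K)) j = 0 := v.2
  have hK : (K : ℝ) ≠ 0 := Nat.cast_ne_zero.2 (NeZero.ne K)
  simp only [centredLog, centre_apply, softmax, Real.log_div (Real.exp_ne_zero _)
    (sum_exp_pos (v : EuclideanSpace ℝ (Fin K))).ne', Real.log_exp, Finset.sum_sub_distrib, hv,
    Finset.sum_const, Finset.card_univ, Fintype.card_fin, nsmul_eq_mul]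
  field_simp
  ring

lemma contDiffAt_centredLog {p : Fin K → ℝ} (hp : ∀ i, p i ≠ 0) :
    ContDiffAt ℝ 1 (centredLog (K := K)) p := by
  have hlog : ContDiffAt ℝ 1 (fun p : Fin K → ℝ => fun i => Real.log (p i)) p :=
    contDiffAt_pi.2 fun i => (contDiff_apply ℝ ℝ i).contDiffAt.log (hp i)
  exact (LinearMap.toContinuousLinearMap (centre K)).contDiff.contDiffAt.comp p hlog

end softmax

/-! ### The cell probabilities as functions of the log-odds -/

/-- The log-odds vectors of the target class prior and of the columns of the confusion matrix. -/
abbrev LogOdds (K : ℕ) : Type := centred K × (Fin K → centred K)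

namespace LogOdds

variable {K : ℕ}

/-- The target class prior with log-odds `x.1`. -/
noncomputable def q (x : LogOdds K) : Fin K → ℝ :=
  softmax (x.1 : EuclideanSpace ℝ (Fin K))

/-- The confusion matrix whose columns have log-odds `x.2`. -/
noncomputable def conf (x : LogOdds K) : Matrix (Fin K) (Fin K) ℝ :=
  Matrix.of fun j i => softmax (x.2 i : EuclideanSpace ℝ (Fin K)) j

/-- The cell probabilities of all samples under the log-odds `x`. -/
noncomputable def cells (x : LogOdds K) : Option (Fin K) → Fin K → ℝ :=
  GSBBSE.cells x.q x.conf

end LogOdds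

/-- The log-odds of a class prior and a confusion matrix. -/
noncomputable def logOdds {K : ℕ} (q : Fin K → ℝ) (C : Matrix (Fin K) (Fin K) ℝ) : LogOdds K :=
  (centredLog q, fun i => centredLog fun j => C j i)

/-- The confusion matrix read off the cell probabilities of the source samples. -/
def confusion {K : ℕ} (w : Option (Fin K) → Fin K → ℝ) : Matrix (Fin K) (Fin K) ℝ :=
  Matrix.of fun j i => w (some i) j

/-- The class prior `C⁻¹ p` that explains the target cell probabilities `p` through the confusion
matrix `C` of the source samples; it is `0` where `C` is singular. -/
noncomputable def classPrior {K : ℕ} (w : Option (Fin K) → Fin K → ℝ) : Fin K → ℝ :=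
  (confusion w)⁻¹.mulVec (w none)

/-- The inverse of `LogOdds.cells` where the confusion matrix is invertible. -/
noncomputable def LogOdds.ofCells {K : ℕ} (w : Option (Fin K) → Fin K → ℝ) : LogOdds K :=
  logOdds (classPrior w) (confusion w)

section cells

variable {K : ℕ} {q : Fin K → ℝ} {C : Matrix (Fin K) (Fin K) ℝ}
  {w : Option (Fin K) → Fin K → ℝ}

lemma sum_mulVec (hC : ∀ i, ∑ j, C j i = 1) (v : Fin K → ℝ) : ∑ j, C.mulVec v j = ∑ j, v j := by
  simp only [Matrix.mulVec, dotProduct]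
  rw [Finset.sum_comm]
  simp only [← Finset.sum_mul, hC, one_mul]

lemma cells_pos (hq : ∀ i, 0 < q i) (hC : ∀ j i, 0 < C j i) (o : Option (Fin K)) (j : Fin K) :
    0 < cells q C o j := by
  cases o with
  | none => exact Finset.sum_pos (fun i _ => mul_pos (hC j i) (hq i)) ⟨j, Finset.mem_univ j⟩
  | some i => exact hC j i

lemma sum_cells (hq : ∑ i, q i = 1) (hC : ∀ i, ∑ j, C j i = 1) (o : Option (Fin K)) :
    ∑ j, cells q C o j = 1 := by
  cases o with
  | none => exact (sum_mulVec hC q).trans hq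
  | some i => exact hC i

lemma cells_mem_stdSimplex (hq : ∀ i, 0 < q i) (hq1 : ∑ i, q i = 1) (hC : ∀ j i, 0 < C j i)
    (hC1 : ∀ i, ∑ j, C j i = 1) (o : Option (Fin K)) : cells q C o ∈ stdSimplex ℝ (Fin K) :=
  ⟨fun j => (cells_pos hq hC o j).le, sum_cells hq1 hC1 o⟩

lemma confusion_cells (q : Fin K → ℝ) (C : Matrix (Fin K) (Fin K) ℝ) :
    confusion (cells q C) = C := rfl

lemma classPrior_cells (hC : C.det ≠ 0) : classPrior (cells q C) = q := by
  change C⁻¹.mulVec (C.mulVec q) = q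
  rw [Matrix.mulVec_mulVec, Matrix.nonsing_inv_mul C hC.isUnit, Matrix.one_mulVec]

lemma cells_classPrior_confusion (hw : (confusion w).det ≠ 0) :
    cells (classPrior w) (confusion w) = w := by
  funext o
  cases o with
  | none =>
    change (confusion w).mulVec ((confusion w)⁻¹.mulVec (w none)) = w none
    rw [Matrix.mulVec_mulVec, Matrix.mul_nonsing_inv _ hw.isUnit, Matrix.one_mulVec]
  | some i => rfl

lemma sum_classPrior (hw : ∀ o, ∑ j, w o j = 1) (hdet : (confusion w).det ≠ 0) :
    ∑ i, classPrior w i = 1 := by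
  rw [← sum_mulVec (C := confusion w) fun i => hw (some i)]
  exact (congrArg (fun v => ∑ j, v none j) (cells_classPrior_confusion hdet)).trans (hw none)

lemma cells_logOdds (hq : ∀ i, 0 < q i) (hq1 : ∑ i, q i = 1) (hC : ∀ j i, 0 < C j i)
    (hC1 : ∀ i, ∑ j, C j i = 1) : (logOdds q C).cells = cells q C := by
  have hprior : (logOdds q C).q = q := softmax_centredLog hq hq1
  have hconf : (logOdds q C).conf = C := by
    ext j i
    exact congrFun (softmax_centredLog (fun j => hC j i) (hC1 i)) j
  rw [LogOdds.cells, hprior, hconf]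

lemma contDiff_det {E n : Type*} [NormedAddCommGroup E] [NormedSpace ℝ E] [Fintype n]
    [DecidableEq n] {M : E → Matrix n n ℝ} {k : WithTop ℕ∞}
    (hM : ∀ i j, ContDiff ℝ k fun x => M x i j) : ContDiff ℝ k fun x => (M x).det := by
  simp only [Matrix.det_apply']
  exact ContDiff.sum fun σ _ => contDiff_const.mul (contDiff_prod fun i _ => hM _ _)

lemma contDiff_confusion_apply (j i : Fin K) :
    ContDiff ℝ 1 fun w : Option (Fin K) → Fin K → ℝ => confusion w j i :=
  (contDiff_apply ℝ ℝ j).comp (contDiff_apply ℝ (Fin K → ℝ) (some i))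

lemma contDiff_det_confusion :
    ContDiff ℝ 1 fun w : Option (Fin K) → Fin K → ℝ => (confusion w).det :=
  contDiff_det contDiff_confusion_apply

lemma classPrior_eq_cramer (w : Option (Fin K) → Fin K → ℝ) :
    classPrior w = (confusion w).det⁻¹ • (confusion w).cramer (w none) := by
  rw [classPrior, Matrix.inv_def, Ring.inverse_eq_inv', Matrix.smul_mulVec,
    Matrix.cramer_eq_adjugate_mulVec]

lemma contDiffAt_classPrior (hw : (confusion w).det ≠ 0) : ContDiffAt ℝ 1 classPrior w := by
  have hcramer : ContDiff ℝ 1 fun w : Option (Fin K) → Fin K → ℝ =>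
      (confusion w).cramer (w none) := by
    refine contDiff_pi.2 fun i => ?_
    simp only [Matrix.cramer_apply]
    refine contDiff_det fun j k => ?_
    simp only [Matrix.updateCol_apply]
    split_ifs
    · exact (contDiff_apply ℝ ℝ j).comp (contDiff_apply ℝ (Fin K → ℝ) none)
    · exact contDiff_confusion_apply j k
  exact ((contDiff_det_confusion.contDiffAt.inv hw).smul hcramer.contDiffAt).congr_of_eventuallyEq
    (Filter.Eventually.of_forall classPrior_eq_cramer)

namespace LogOdds

lemma cells_pos (x : LogOdds K) (o : Option (Fin K)) (j : Fin K) : 0 < x.cells o j :=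
  GSBBSE.cells_pos (fun _ => softmax_pos _ _) (fun _ _ => softmax_pos _ _) o j

lemma cells_mem_stdSimplex [NeZero K] (x : LogOdds K) (o : Option (Fin K)) :
    x.cells o ∈ stdSimplex ℝ (Fin K) :=
  GSBBSE.cells_mem_stdSimplex (fun _ => softmax_pos _ _) (softmax_mem_stdSimplex _).2
    (fun _ _ => softmax_pos _ _) (fun _ => (softmax_mem_stdSimplex _).2) o

lemma contDiff_q [NeZero K] : ContDiff ℝ 1 (LogOdds.q (K := K)) :=
  contDiff_softmax.comp ((centred K).subtypeL.contDiff.comp contDiff_fst)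

lemma contDiff_conf_apply [NeZero K] (j i : Fin K) : ContDiff ℝ 1 fun x : LogOdds K => x.conf j i :=
  (contDiff_apply ℝ ℝ j).comp (contDiff_softmax.comp
    ((centred K).subtypeL.contDiff.comp ((contDiff_apply ℝ _ i).comp contDiff_snd)))

lemma contDiff_cells [NeZero K] : ContDiff ℝ 1 (cells (K := K)) := by
  refine contDiff_pi.2 fun o => contDiff_pi.2 fun j => ?_
  cases o with
  | none =>
    change ContDiff ℝ 1 fun x : LogOdds K => ∑ i, x.conf j i * x.q i
    exact ContDiff.sum fun i _ =>
      (contDiff_conf_apply j i).mul ((contDiff_apply ℝ ℝ i).comp contDiff_q)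
  | some i => exact contDiff_conf_apply j i

lemma logOdds_q_conf [NeZero K] (x : LogOdds K) : logOdds x.q x.conf = x :=
  Prod.ext (centredLog_softmax x.1) (funext fun i => centredLog_softmax (x.2 i))

lemma ofCells_cells [NeZero K] {x : LogOdds K} (hx : x.conf.det ≠ 0) : ofCells x.cells = x := by
  rw [ofCells, cells, classPrior_cells hx, confusion_cells, logOdds_q_conf]

lemma cells_ofCells (hw : ∀ o, w o ∈ stdSimplex ℝ (Fin K)) (hdet : (confusion w).det ≠ 0)
    (hpos : ∀ j i, 0 < confusion w j i) (hprior : ∀ i, 0 < classPrior w i) :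
    (ofCells w).cells = w := by
  rw [ofCells, cells_logOdds hprior (sum_classPrior (fun o => (hw o).2) hdet) hpos
    fun i => (hw (some i)).2, cells_classPrior_confusion hdet]

lemma contDiffAt_ofCells (hdet : (confusion w).det ≠ 0) (hpos : ∀ j i, confusion w j i ≠ 0)
    (hprior : ∀ i, classPrior w i ≠ 0) : ContDiffAt ℝ 1 ofCells w := by
  refine ((contDiffAt_centredLog hprior).comp w (contDiffAt_classPrior hdet)).prodMk
    (contDiffAt_pi.2 fun i => ?_)
  exact (contDiffAt_centredLog fun j => hpos j i).comp (f := fun w => w (some i)) w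
    (contDiff_apply ℝ (Fin K → ℝ) (some i)).contDiffAt

end LogOdds

end cells

/-! ### Bi-Lipschitz charts -/

/-- A bi-Lipschitz parametrisation near `z`: over `ball z r` the map `Φ`, which takes its values
in the constraint set `P`, is inverted by `Ψ`, and both are Lipschitz with constant `L`. -/
structure IsLipschitzChart {X Z : Type*} [PseudoMetricSpace X] [PseudoMetricSpace Z] (Φ : X → Z)
    (Ψ : Z → X) (P : Set Z) (z : Z) (r : ℝ) (L : ℝ≥0) : Prop where
  mem : ∀ x, Φ x ∈ P
  left_inv : ∀ x, Φ x ∈ ball z r → Ψ (Φ x) = x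
  right_inv : ∀ w ∈ ball z r ∩ P, Φ (Ψ w) = w
  lipschitz : LipschitzOnWith L Φ (Φ ⁻¹' ball z r)
  lipschitz_symm : LipschitzOnWith L Ψ (ball z r)

lemma IsLipschitzChart.mono {X Z : Type*} [PseudoMetricSpace X] [PseudoMetricSpace Z] {Φ : X → Z}
    {Ψ : Z → X} {P : Set Z} {z : Z} {r r' : ℝ} {L : ℝ≥0} (h : IsLipschitzChart Φ Ψ P z r L)
    (hr : r' ≤ r) : IsLipschitzChart Φ Ψ P z r' L where
  mem := h.mem
  left_inv x hx := h.left_inv x (ball_subset_ball hr hx)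
  right_inv w hw := h.right_inv w ⟨ball_subset_ball hr hw.1, hw.2⟩
  lipschitz := h.lipschitz.mono (preimage_mono (ball_subset_ball hr))
  lipschitz_symm := h.lipschitz_symm.mono (ball_subset_ball hr)

lemma exists_isLipschitzChart {X Z : Type*} [NormedAddCommGroup X] [NormedSpace ℝ X]
    [NormedAddCommGroup Z] [NormedSpace ℝ Z] {Φ : X → Z} {Ψ : Z → X} {P : Set Z} {z : Z}
    (hΦ : ContDiffAt ℝ 1 Φ (Ψ z)) (hΨ : ContDiffAt ℝ 1 Ψ z) (hP : ∀ x, Φ x ∈ P)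
    (hleft : ∀ᶠ w in 𝓝 z, ∀ x, Φ x = w → Ψ w = x)
    (hright : ∀ᶠ w in 𝓝 z, w ∈ P → Φ (Ψ w) = w) :
    ∃ r > 0, ∃ L, IsLipschitzChart Φ Ψ P z r L := by
  obtain ⟨L₁, s, hs, hL₁⟩ := hΦ.exists_lipschitzOnWith
  obtain ⟨L₂, t, ht, hL₂⟩ := hΨ.exists_lipschitzOnWith
  obtain ⟨r, hr, hball⟩ := Metric.eventually_nhds_iff_ball.1 ((hleft.and hright).and
    ((hΨ.continuousAt.eventually hs).and ht))
  refine ⟨r, hr, max L₁ L₂, hP, fun x hx => (hball _ hx).1.1 x rfl,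
    fun w hw => (hball w hw.1).1.2 hw.2, ?_, ?_⟩
  · refine (hL₁.mono fun x hx => ?_).weaken (le_max_left _ _)
    rw [← (hball _ hx).1.1 x rfl]
    exact (hball _ hx).2.1
  · exact (hL₂.mono fun w hw => (hball w hw).2.2).weaken (le_max_right _ _)

-- Points `x` with `Φ x` far from `f` are covered by the boundedness of `v`.
lemma exists_dist_le_mul_dist {X Y Z : Type*} [PseudoMetricSpace Y] [PseudoMetricSpace Z]
    {Φ : X → Z} {v : X → Y} {g : Z → Y} {z : Z} {r D : ℝ} {L : ℝ≥0} (hr : 0 < r)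
    (hg : LipschitzOnWith L g (ball z r)) (hv : ∀ x y, dist (v x) (v y) ≤ D)
    (hvg : ∀ x, Φ x ∈ ball z r → v x = g (Φ x)) (hz : z ∈ range Φ) :
    ∃ A : ℝ≥0, ∀ f ∈ ball z (r / 2), ∀ x, dist (v x) (g f) ≤ A * dist (Φ x) f := by
  obtain ⟨x₀, rfl⟩ := hz
  have hD : 0 ≤ D := dist_nonneg.trans (hv x₀ x₀)
  refine ⟨max L ((D + L * r) / (r / 2)).toNNReal, fun f hf x => ?_⟩
  have hfr : f ∈ ball (Φ x₀) r := ball_subset_ball (by linarith) hf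
  rw [NNReal.coe_max, max_mul_of_nonneg _ _ dist_nonneg, le_max_iff]
  by_cases hx : Φ x ∈ ball (Φ x₀) r
  · exact Or.inl (hvg x hx ▸ hg.dist_le_mul _ hx _ hfr)
  · refine Or.inr ?_
    have hfar : r / 2 ≤ dist (Φ x) f := by
      have := dist_triangle (Φ x) f (Φ x₀)
      rw [mem_ball] at hf hx
      linarith
    have hnear : dist (v x₀) (g f) ≤ L * r := by
      rw [hvg x₀ (mem_ball_self hr)]
      refine (hg.dist_le_mul _ (mem_ball_self hr) _ hfr).trans ?_
      rw [dist_comm]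
      gcongr
      exact (mem_ball.1 hfr).le
    calc dist (v x) (g f) ≤ D + L * r := (dist_triangle _ _ _).trans (add_le_add (hv x x₀) hnear)
      _ = (D + L * r) / (r / 2) * (r / 2) := by field_simp
      _ ≤ (D + L * r) / (r / 2) * dist (Φ x) f := by gcongr
      _ ≤ _ := by gcongr; exact Real.le_coe_toNNReal _

section logOddsChart

variable {K : ℕ} {q₀ : Fin K → ℝ} {C₀ : Matrix (Fin K) (Fin K) ℝ}

lemma eventually_det_confusion_ne_zero (hdet : C₀.det ≠ 0) :
    ∀ᶠ w in 𝓝 (cells q₀ C₀), (confusion w).det ≠ 0 :=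
  contDiff_det_confusion.continuous.continuousAt.eventually_ne hdet

variable [NeZero K]

lemma exists_isLipschitzChart_cells (hq : ∀ i, 0 < q₀ i) (hC : ∀ j i, 0 < C₀ j i)
    (hdet : C₀.det ≠ 0) :
    ∃ r > 0, ∃ L, IsLipschitzChart LogOdds.cells LogOdds.ofCells
      (univ.pi fun _ => stdSimplex ℝ (Fin K)) (cells q₀ C₀) r L := by
  have hprior : ContDiffAt ℝ 1 classPrior (cells q₀ C₀) := contDiffAt_classPrior hdet
  have hprior0 : classPrior (cells q₀ C₀) = q₀ := classPrior_cells hdet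
  have hev_prior : ∀ᶠ w in 𝓝 (cells q₀ C₀), ∀ i, 0 < classPrior w i :=
    Filter.eventually_all.2 fun i => (continuousAt_pi.1 hprior.continuousAt i).eventually_const_lt
      ((hq i).trans_eq (congrFun hprior0 i).symm)
  have hev_conf : ∀ᶠ w in 𝓝 (cells q₀ C₀), ∀ j i, 0 < confusion w j i :=
    Filter.eventually_all.2 fun j => Filter.eventually_all.2 fun i =>
      (contDiff_confusion_apply j i).continuous.continuousAt.eventually_const_lt (hC j i)
  refine exists_isLipschitzChart LogOdds.contDiff_cells.contDiffAt
    (LogOdds.contDiffAt_ofCells hdet (fun j i => (hC j i).ne')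
      fun i => (congrFun hprior0 i).trans_ne (hq i).ne')
    (fun x o _ => x.cells_mem_stdSimplex o) ?_ ?_
  · filter_upwards [eventually_det_confusion_ne_zero hdet] with w hw x hx
    subst hx
    exact LogOdds.ofCells_cells hw
  · filter_upwards [eventually_det_confusion_ne_zero hdet, hev_prior, hev_conf]
      with w hwdet hwprior hwconf hw
    exact LogOdds.cells_ofCells (fun o => hw o (mem_univ o)) hwdet hwconf hwprior

lemma exists_dist_q_classPrior_le (hq : ∀ i, 0 < q₀ i) (hq1 : ∑ i, q₀ i = 1)
    (hC : ∀ j i, 0 < C₀ j i) (hC1 : ∀ i, ∑ j, C₀ j i = 1) (hdet : C₀.det ≠ 0) :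
    ∃ r > 0, ∃ A : ℝ≥0, ∀ f ∈ ball (cells q₀ C₀) r, ∀ x : LogOdds K,
      dist x.q (classPrior f) ≤ A * dist x.cells f := by
  obtain ⟨L, s, hs, hL⟩ :=
    (contDiffAt_classPrior (w := cells q₀ C₀) hdet).exists_lipschitzOnWith
  obtain ⟨r, hr, hball⟩ := Metric.eventually_nhds_iff_ball.1
    ((eventually_det_confusion_ne_zero hdet).and (Filter.eventually_mem_set.2 hs))
  have hbdd : Bornology.IsBounded (range (LogOdds.q (K := K))) :=
    (bounded_stdSimplex (Fin K)).subset (range_subset_iff.2 fun x => softmax_mem_stdSimplex _)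
  obtain ⟨D, hD⟩ := isBounded_range_iff.1 hbdd
  obtain ⟨A, hA⟩ := exists_dist_le_mul_dist hr (hL.mono fun w hw => (hball w hw).2) hD
    (fun x hx => (classPrior_cells (hball _ hx).1).symm)
    ⟨logOdds q₀ C₀, cells_logOdds hq hq1 hC hC1⟩
  exact ⟨r / 2, half_pos hr, A, hA⟩

end logOddsChart

/-! ### Volume distortion and contraction towards a point -/

section volume

variable {X : Type*} [NormedAddCommGroup X] [NormedSpace ℝ X] [FiniteDimensional ℝ X]
  [MeasurableSpace X] [BorelSpace X] (μ : Measure X) [μ.IsAddHaarMeasure] {s U : Set X} {T : X → X}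
  {L : ℝ≥0} {F G : X → ℝ}

lemma addHaar_le_mul_addHaar_image (hT : ∀ x ∈ s, ∀ y ∈ s, dist x y ≤ L * dist (T x) (T y)) :
    μ s ≤ (L : ℝ≥0∞) ^ Module.finrank ℝ X * μ (T '' s) := by
  have hres : AntilipschitzWith L (s.domRestrict T) :=
    AntilipschitzWith.of_le_mul_dist fun x y => hT x x.2 y y.2
  have hH := hres.le_hausdorffMeasure_image (Nat.cast_nonneg (Module.finrank ℝ X)) univ
  rw [← isometry_subtype_coe.hausdorffMeasure_image (Or.inl (Nat.cast_nonneg _)), image_univ,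
    Subtype.range_coe, image_univ, range_domRestrict, ENNReal.rpow_natCast] at hH
  rw [Measure.isAddLeftInvariant_eq_smul μ (Measure.hausdorffMeasure (Module.finrank ℝ X : ℝ))]
  simp only [Measure.smul_apply, ENNReal.smul_def, smul_eq_mul]
  rw [mul_left_comm]
  gcongr

lemma setLIntegral_le_mul_setLIntegral_of_le_comp (hU : MeasurableSet U) (hTU : MapsTo T U U)
    (hT : ∀ x ∈ U, ∀ y ∈ U, dist x y ≤ L * dist (T x) (T y)) (hF : Measurable F)
    (hG : Measurable G) (hF0 : 0 ≤ F) (hG0 : 0 ≤ G) (hFG : ∀ x ∈ U, F x ≤ G (T x)) :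
    ∫⁻ x in U, ENNReal.ofReal (F x) ∂μ ≤
      (L : ℝ≥0∞) ^ Module.finrank ℝ X * ∫⁻ x in U, ENNReal.ofReal (G x) ∂μ := by
  rw [lintegral_eq_lintegral_meas_le _ (ae_of_all _ hF0) hF.aemeasurable,
    lintegral_eq_lintegral_meas_le _ (ae_of_all _ hG0) hG.aemeasurable,
    ← lintegral_const_mul' _ _ (ENNReal.pow_ne_top ENNReal.coe_ne_top)]
  refine lintegral_mono fun t => ?_
  simp only [Measure.restrict_apply' hU]
  refine (addHaar_le_mul_addHaar_image μ fun x hx y hy => hT x hx.2 y hy.2).trans ?_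
  gcongr
  rintro _ ⟨x, ⟨htx, hx⟩, rfl⟩
  exact ⟨(show t ≤ F x from htx).trans (hFG x hx), hTU hx⟩

end volume

section contraction

variable {X Z : Type*} [PseudoMetricSpace X] [NormedAddCommGroup Z] [NormedSpace ℝ Z]
  {Φ : X → Z} {Ψ : Z → X} {P : Set Z} {z f : Z} {r : ℝ} {L : ℝ≥0}

namespace IsLipschitzChart

lemma apply_midpoint (h : IsLipschitzChart Φ Ψ P z r L) (hP : Convex ℝ P) (hf : f ∈ ball z r ∩ P)
    {x : X} (hx : Φ x ∈ ball z r) :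
    Φ (Ψ (midpoint ℝ (Φ x) f)) = midpoint ℝ (Φ x) f :=
  h.right_inv _ ⟨(convex_ball z r).midpoint_mem hx hf.1, hP.midpoint_mem (h.mem x) hf.2⟩

lemma mapsTo_midpoint (h : IsLipschitzChart Φ Ψ P z r L) (hP : Convex ℝ P)
    (hf : f ∈ ball z r ∩ P) :
    MapsTo (fun x => Ψ (midpoint ℝ (Φ x) f)) (Φ ⁻¹' ball z r) (Φ ⁻¹' ball z r) := fun x hx => by
  rw [mem_preimage, h.apply_midpoint hP hf hx]
  exact (convex_ball z r).midpoint_mem hx hf.1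

lemma dist_le_mul_dist_midpoint (h : IsLipschitzChart Φ Ψ P z r L) (hP : Convex ℝ P)
    (hf : f ∈ ball z r ∩ P) {x y : X} (hx : Φ x ∈ ball z r) (hy : Φ y ∈ ball z r) :
    dist x y ≤ (2 * L ^ 2 : ℝ≥0) *
      dist (Ψ (midpoint ℝ (Φ x) f)) (Ψ (midpoint ℝ (Φ y) f)) := by
  have hhalf : dist (Φ x) (Φ y) = 2 * dist (midpoint ℝ (Φ x) f) (midpoint ℝ (Φ y) f) := by
    simp only [dist_eq_norm, midpoint_eq_smul_add, ← smul_sub, add_sub_add_right_eq_sub, norm_smul]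
    norm_num
    ring
  calc dist x y = dist (Ψ (Φ x)) (Ψ (Φ y)) := by rw [h.left_inv x hx, h.left_inv y hy]
    _ ≤ L * dist (Φ x) (Φ y) := h.lipschitz_symm.dist_le_mul _ hx _ hy
    _ = L * (2 * dist (Φ (Ψ (midpoint ℝ (Φ x) f))) (Φ (Ψ (midpoint ℝ (Φ y) f)))) := by
      rw [h.apply_midpoint hP hf hx, h.apply_midpoint hP hf hy, hhalf]
    _ ≤ L * (2 * (L * dist (Ψ (midpoint ℝ (Φ x) f)) (Ψ (midpoint ℝ (Φ y) f)))) := by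
      gcongr
      exact h.lipschitz.dist_le_mul _ (h.mapsTo_midpoint hP hf hx) _ (h.mapsTo_midpoint hP hf hy)
    _ = _ := by push_cast; ring

end IsLipschitzChart

end contraction

/-! ### The deviance -/

/-- The deviance of the cell probabilities `w` from the observed frequencies `f` for samples of
sizes `n`: up to a summand that does not depend on `w`, the negative log-likelihood. -/
noncomputable def deviance {κ ι : Type*} [Fintype κ] [Fintype ι] (n : κ → ℕ) (f w : κ → ι → ℝ) :
    ℝ :=
  ∑ o, n o * relEnt (f o) (w o)

section deviance

variable {κ ι : Type*} [Fintype κ] [Fintype ι] {n : κ → ℕ} {f w : κ → ι → ℝ}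

@[fun_prop]
lemma measurable_deviance (n : κ → ℕ) (f : κ → ι → ℝ) : Measurable (deviance n f) := by
  unfold deviance
  fun_prop

lemma mul_relEnt_le_deviance (hf : ∀ o, f o ∈ stdSimplex ℝ ι) (hw : ∀ o, w o ∈ stdSimplex ℝ ι)
    (hw0 : ∀ o j, 0 < w o j) (o : κ) : n o * relEnt (f o) (w o) ≤ deviance n f w :=
  Finset.single_le_sum (f := fun o => n o * relEnt (f o) (w o))
    (fun o _ => mul_nonneg (Nat.cast_nonneg _) (relEnt_nonneg (hf o) (hw o) (hw0 o)))
    (Finset.mem_univ o)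

lemma deviance_nonneg (hf : ∀ o, f o ∈ stdSimplex ℝ ι) (hw : ∀ o, w o ∈ stdSimplex ℝ ι)
    (hw0 : ∀ o j, 0 < w o j) : 0 ≤ deviance n f w :=
  Finset.sum_nonneg fun o _ =>
    mul_nonneg (Nat.cast_nonneg _) (relEnt_nonneg (hf o) (hw o) (hw0 o))

lemma mul_dist_sq_le_deviance (hf : ∀ o, f o ∈ stdSimplex ℝ ι) (hw : ∀ o, w o ∈ stdSimplex ℝ ι)
    (hw0 : ∀ o j, 0 < w o j) {m : ℝ} (hm0 : 0 ≤ m) (hm : ∀ o, m ≤ n o) :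
    m * dist w f ^ 2 ≤ 4 * deviance n f w := by
  have hrow (o : κ) : m * ‖(w - f) o‖ ^ 2 ≤ 4 * deviance n f w :=
    calc m * ‖w o - f o‖ ^ 2 ≤ n o * (4 * relEnt (f o) (w o)) := by
          gcongr
          exacts [hm o, sq_norm_sub_le_relEnt (hf o) (hw o) (hw0 o)]
      _ = 4 * (n o * relEnt (f o) (w o)) := by ring
      _ ≤ 4 * deviance n f w := by
          gcongr
          exact mul_relEnt_le_deviance hf hw hw0 o
  have hsup : ‖√m • (w - f)‖ ≤ √(4 * deviance n f w) :=
    (pi_norm_le_iff_of_nonneg (Real.sqrt_nonneg _)).2 fun o => Real.le_sqrt_of_sq_le <| by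
      rw [Pi.smul_apply, norm_smul, mul_pow, Real.norm_of_nonneg (Real.sqrt_nonneg m),
        Real.sq_sqrt hm0]
      exact hrow o
  rw [Real.le_sqrt (norm_nonneg _) (mul_nonneg four_pos.le (deviance_nonneg hf hw hw0)),
    norm_smul, mul_pow, Real.norm_of_nonneg (Real.sqrt_nonneg m), Real.sq_sqrt hm0] at hsup
  rwa [dist_eq_norm]

lemma two_mul_deviance_midpoint_le (hf : ∀ o j, 0 ≤ f o j) (hw : ∀ o j, 0 < w o j) :
    2 * deviance n f (midpoint ℝ w f) ≤ deviance n f w := by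
  rw [deviance, deviance, Finset.mul_sum]
  refine Finset.sum_le_sum fun o _ => ?_
  rw [pi_midpoint_apply, mul_left_comm]
  exact mul_le_mul_of_nonneg_left (two_mul_relEnt_midpoint_le (hf o) (hw o)) (Nat.cast_nonneg _)

lemma eventually_deviance_le {z : κ → ι → ℝ} (hz : ∀ o j, z o j ≠ 0) {c : ℝ} (hc : 0 < c) :
    ∀ᶠ x in 𝓝 (z, z), ∀ n : κ → ℕ, deviance n x.1 x.2 ≤ c * ∑ o, (n o : ℝ) := by
  have hrow (o : κ) : ∀ᶠ x in 𝓝 (z, z), relEnt (x.1 o) (x.2 o) < c :=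
    (ContinuousAt.comp (x := (z, z)) (g := fun y : (ι → ℝ) × (ι → ℝ) => relEnt y.1 y.2)
      (f := fun x : (κ → ι → ℝ) × (κ → ι → ℝ) => (x.1 o, x.2 o))
      (continuousAt_relEnt (hz o)) (by fun_prop)).eventually_lt_const
        (by simpa only [Function.comp_apply, relEnt_self] using hc)
  filter_upwards [Filter.eventually_all.2 hrow] with x hx n
  rw [deviance, Finset.mul_sum]
  refine Finset.sum_le_sum fun o _ => ?_
  rw [mul_comm]
  exact mul_le_mul_of_nonneg_right (hx o).le (Nat.cast_nonneg _)

end deviance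

lemma likelihood_eq_mul_exp_deviance {K : ℕ} {nS : Fin K → ℕ} {nT : ℕ} {q : Fin K → ℝ}
    {C : Matrix (Fin K) (Fin K) ℝ} (hz : ∀ o j, 0 < cells q C o j)
    (hsize : ∀ o, sizes nS nT o ≠ 0) (d : Data K) :
    likelihood nS nT q C d =
      (∏ o, multinomialProb (sizes nS nT o) (frequencies nS nT d o) (counts d o)) *
        Real.exp (-deviance (sizes nS nT) (frequencies nS nT d) (cells q C)) := by
  rw [likelihood_eq_prod, deviance, ← Finset.sum_neg_distrib, Real.exp_sum,
    ← Finset.prod_mul_distrib]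
  refine Finset.prod_congr rfl fun o _ => multinomialProb_eq_mul_exp_relEnt (hz o)
    (fun j => div_nonneg (Nat.cast_nonneg _) (Nat.cast_nonneg _)) fun j => ?_
  exact (mul_div_cancel₀ _ (Nat.cast_ne_zero.2 (hsize o))).symm

lemma prod_multinomialProb_frequencies_pos {K : ℕ} {nS : Fin K → ℕ} {nT : ℕ} {d : Data K}
    (hd : d ∈ dataSupport nS nT) (hsize : ∀ o, sizes nS nT o ≠ 0) :
    0 < ∏ o, multinomialProb (sizes nS nT o) (frequencies nS nT d o) (counts d o) :=
  Finset.prod_pos fun o _ => multinomialProb_pos (mem_dataSupport.1 hd o) fun _ hj =>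
    div_pos (Nat.cast_pos.2 (Nat.pos_of_ne_zero hj))
      (Nat.cast_pos.2 (Nat.pos_of_ne_zero (hsize o)))

/-! ### Concentration of the deviance -/

lemma self_mul_exp_neg_le (s : ℝ) : s * Real.exp (-s) ≤ Real.exp (-(s / 2)) := by
  have hs : s ≤ Real.exp (s / 2) := by
    have hquarter := Real.add_one_le_exp (s / 4)
    rw [show s / 2 = s / 4 + s / 4 by ring, Real.exp_add]
    nlinarith [sq_nonneg (1 - s / 4), Real.exp_pos (s / 4)]
  calc s * Real.exp (-s) ≤ Real.exp (s / 2) * Real.exp (-s) := by gcongr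
    _ = Real.exp (-(s / 2)) := by rw [← Real.exp_add]; congr 1; ring

section exponentialWeights

variable {X : Type*} [MeasurableSpace X] {μ : Measure X} {S : X → ℝ} {π : X → ℝ≥0∞} {U : Set X}

lemma setLIntegral_exp_half_mul_le (hS : Measurable S) (hU : MeasurableSet U) {a c : ℝ≥0∞}
    (hlow : ∀ x ∈ U, a ≤ π x) (hup : ∀ x ∈ U, π x ≤ 4 * a)
    (hhalf : ∫⁻ x in U, ENNReal.ofReal (Real.exp (-(S x / 2))) ∂μ ≤
      c * ∫⁻ x in U, ENNReal.ofReal (Real.exp (-S x)) ∂μ) :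
    ∫⁻ x in U, ENNReal.ofReal (Real.exp (-(S x / 2))) * π x ∂μ ≤
      4 * c * ∫⁻ x, ENNReal.ofReal (Real.exp (-S x)) * π x ∂μ :=
  calc ∫⁻ x in U, ENNReal.ofReal (Real.exp (-(S x / 2))) * π x ∂μ
      ≤ ∫⁻ x in U, ENNReal.ofReal (Real.exp (-(S x / 2))) * (4 * a) ∂μ :=
        setLIntegral_mono' hU fun x hx => mul_le_mul_right (hup x hx) _
    _ = (∫⁻ x in U, ENNReal.ofReal (Real.exp (-(S x / 2))) ∂μ) * (4 * a) :=
        lintegral_mul_const _ (by fun_prop)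
    _ ≤ (c * ∫⁻ x in U, ENNReal.ofReal (Real.exp (-S x)) ∂μ) * (4 * a) := by gcongr
    _ = 4 * c * ∫⁻ x in U, ENNReal.ofReal (Real.exp (-S x)) * a ∂μ := by
        rw [lintegral_mul_const _ (by fun_prop)]
        ring
    _ ≤ 4 * c * ∫⁻ x in U, ENNReal.ofReal (Real.exp (-S x)) * π x ∂μ :=
        mul_le_mul_right (setLIntegral_mono' hU fun x hx => mul_le_mul_right (hlow x hx) _) _
    _ ≤ 4 * c * ∫⁻ x, ENNReal.ofReal (Real.exp (-S x)) * π x ∂μ := by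
        gcongr
        exact Measure.restrict_le_self

lemma setLIntegral_exp_half_mul_compl_le (hπ : Measurable π) (hπ1 : ∫⁻ x, π x ∂μ ≤ 1)
    (hU : MeasurableSet U) {E : ℝ} (hfar : ∀ x ∉ U, 2 * E ≤ S x) :
    ∫⁻ x in Uᶜ, ENNReal.ofReal (Real.exp (-(S x / 2))) * π x ∂μ ≤
      ENNReal.ofReal (Real.exp (-E)) :=
  calc ∫⁻ x in Uᶜ, ENNReal.ofReal (Real.exp (-(S x / 2))) * π x ∂μ
      ≤ ∫⁻ x in Uᶜ, ENNReal.ofReal (Real.exp (-E)) * π x ∂μ := by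
        refine setLIntegral_mono' hU.compl fun x hx => ?_
        gcongr
        linarith [hfar x hx]
    _ ≤ ∫⁻ x, ENNReal.ofReal (Real.exp (-E)) * π x ∂μ := setLIntegral_le_lintegral _ _
    _ = ENNReal.ofReal (Real.exp (-E)) * ∫⁻ x, π x ∂μ := lintegral_const_mul _ hπ
    _ ≤ ENNReal.ofReal (Real.exp (-E)) := mul_le_of_le_one_right' hπ1

lemma lintegral_mul_exp_neg_mul_le (hS : Measurable S) (hπ : Measurable π)
    (hπ1 : ∫⁻ x, π x ∂μ ≤ 1) (hU : MeasurableSet U) {a c : ℝ≥0∞} {E : ℝ}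
    (hlow : ∀ x ∈ U, a ≤ π x) (hup : ∀ x ∈ U, π x ≤ 4 * a)
    (hhalf : ∫⁻ x in U, ENNReal.ofReal (Real.exp (-(S x / 2))) ∂μ ≤
      c * ∫⁻ x in U, ENNReal.ofReal (Real.exp (-S x)) ∂μ)
    (hfar : ∀ x ∉ U, 2 * E ≤ S x)
    (hev : ENNReal.ofReal (Real.exp (-E)) ≤ ∫⁻ x, ENNReal.ofReal (Real.exp (-S x)) * π x ∂μ) :
    ∫⁻ x, ENNReal.ofReal (S x * Real.exp (-S x)) * π x ∂μ ≤
      (4 * c + 1) * ∫⁻ x, ENNReal.ofReal (Real.exp (-S x)) * π x ∂μ :=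
  calc ∫⁻ x, ENNReal.ofReal (S x * Real.exp (-S x)) * π x ∂μ
      ≤ ∫⁻ x, ENNReal.ofReal (Real.exp (-(S x / 2))) * π x ∂μ :=
        lintegral_mono fun x => mul_le_mul_left
          (ENNReal.ofReal_le_ofReal (self_mul_exp_neg_le (S x))) _
    _ = (∫⁻ x in U, ENNReal.ofReal (Real.exp (-(S x / 2))) * π x ∂μ) +
          ∫⁻ x in Uᶜ, ENNReal.ofReal (Real.exp (-(S x / 2))) * π x ∂μ :=
        (lintegral_add_compl _ hU).symm
    _ ≤ 4 * c * (∫⁻ x, ENNReal.ofReal (Real.exp (-S x)) * π x ∂μ) +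
          ∫⁻ x, ENNReal.ofReal (Real.exp (-S x)) * π x ∂μ :=
        add_le_add (setLIntegral_exp_half_mul_le hS hU hlow hup hhalf)
          ((setLIntegral_exp_half_mul_compl_le hπ hπ1 hU hfar).trans hev)
    _ = _ := by ring

end exponentialWeights

section evidence

variable {X κ ι : Type*} [TopologicalSpace X] [MeasurableSpace X] {μ : Measure X}
  [μ.IsOpenPosMeasure] [Fintype κ] [Fintype ι] {Φ : X → κ → ι → ℝ} {π : X → ℝ≥0∞} {x₀ : X}

lemma exists_exp_neg_le_lintegral_exp_neg_deviance (hΦ : Measurable Φ) (hΦc : ContinuousAt Φ x₀)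
    (hΦ0 : ∀ o j, Φ x₀ o j ≠ 0) (hπ : Measurable π) (hπc : ContinuousAt π x₀) (hπ0 : π x₀ ≠ 0)
    {c : ℝ} (hc : 0 < c) :
    ∃ ε > 0, ∃ N₀ : ℕ, ∀ n : κ → ℕ, N₀ ≤ ∑ o, n o → ∀ f ∈ ball (Φ x₀) ε,
      ENNReal.ofReal (Real.exp (-(c * ∑ o, (n o : ℝ)))) ≤
        ∫⁻ x, ENNReal.ofReal (Real.exp (-deviance n f (Φ x))) * π x ∂μ := by
  obtain ⟨a, ha0, ha⟩ := exists_between (pos_iff_ne_zero.2 hπ0)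
  obtain ⟨ε, hε, hdev⟩ := Metric.eventually_nhds_iff_ball.1
    (eventually_deviance_le hΦ0 (half_pos hc))
  set V : Set X := Φ ⁻¹' ball (Φ x₀) ε ∩ π ⁻¹' Ici a
  have hV : MeasurableSet V := (hΦ measurableSet_ball).inter (hπ measurableSet_Ici)
  have hV0 : 0 < a * μ V := ENNReal.mul_pos ha0.ne' (μ.measure_pos_of_mem_nhds (Filter.inter_mem
    (hΦc (ball_mem_nhds _ hε)) (hπc (Ici_mem_nhds ha)))).ne'
  have htend : Filter.Tendsto (fun N : ℕ => ENNReal.ofReal (Real.exp (-(c / 2 * N))))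
      Filter.atTop (𝓝 0) := by
    rw [← ENNReal.ofReal_zero]
    exact ENNReal.tendsto_ofReal (Real.tendsto_exp_neg_atTop_nhds_zero.comp
      (tendsto_natCast_atTop_atTop.const_mul_atTop (half_pos hc)))
  obtain ⟨N₀, hN₀⟩ := Filter.eventually_atTop.1 (htend.eventually_le_const hV0)
  refine ⟨ε, hε, N₀, fun n hn f hf => ?_⟩
  have hsmall := hN₀ _ hn
  push_cast at hsmall
  set e : ℝ≥0∞ := ENNReal.ofReal (Real.exp (-(c / 2 * ∑ o, (n o : ℝ))))
  calc ENNReal.ofReal (Real.exp (-(c * ∑ o, (n o : ℝ)))) = e * e := by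
        rw [← ENNReal.ofReal_mul (by positivity), ← Real.exp_add]
        congr 2
        ring
    _ ≤ e * (a * μ V) := by gcongr
    _ = ∫⁻ _x in V, e * a ∂μ := by rw [setLIntegral_const, mul_assoc]
    _ ≤ ∫⁻ x in V, ENNReal.ofReal (Real.exp (-deviance n f (Φ x))) * π x ∂μ := by
        refine setLIntegral_mono' hV fun x hx => mul_le_mul' ?_ hx.2
        have hfx : (f, Φ x) ∈ ball (Φ x₀, Φ x₀) ε := by
          rw [← ball_prod_same]
          exact ⟨hf, hx.1⟩
        exact ENNReal.ofReal_le_ofReal (Real.exp_le_exp.2 (neg_le_neg (hdev _ hfx n)))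
    _ ≤ _ := setLIntegral_le_lintegral _ _

end evidence

namespace IsLipschitzChart

lemma eventually_forall_of_eventually {X Z : Type*} [PseudoMetricSpace X] [PseudoMetricSpace Z]
    {Φ : X → Z} {Ψ : Z → X} {P : Set Z} {r : ℝ} {L : ℝ≥0} {x₀ : X}
    (h : IsLipschitzChart Φ Ψ P (Φ x₀) r L) (hr : 0 < r) {p : X → Prop} (hp : ∀ᶠ x in 𝓝 x₀, p x) :
    ∀ᶠ w in 𝓝 (Φ x₀), ∀ x, Φ x = w → p x := by
  have hball : ball (Φ x₀) r ∈ 𝓝 (Φ x₀) := ball_mem_nhds _ hr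
  have hΨ : Filter.Tendsto Ψ (𝓝 (Φ x₀)) (𝓝 x₀) := by
    have hcont := h.lipschitz_symm.continuousOn.continuousAt hball
    rwa [ContinuousAt, h.left_inv x₀ (mem_ball_self hr)] at hcont
  filter_upwards [hΨ.eventually hp, hball] with w hw hwr x hx
  subst hx
  rwa [h.left_inv x hwr] at hw

lemma le_deviance_of_notMem_ball {X κ ι : Type*} [PseudoMetricSpace X] [Fintype κ] [Fintype ι]
    {Φ : X → κ → ι → ℝ} {Ψ : (κ → ι → ℝ) → X} {z f : κ → ι → ℝ} {r : ℝ} {L : ℝ≥0}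
    (h : IsLipschitzChart Φ Ψ (univ.pi fun _ => stdSimplex ℝ ι) z r L)
    (hΦ0 : ∀ x o j, 0 < Φ x o j) {s m : ℝ} (hs : 0 ≤ s) (hf : f ∈ ball z (s / 2))
    (hf1 : ∀ o, f o ∈ stdSimplex ℝ ι) {n : κ → ℕ} (hm0 : 0 ≤ m) (hm : ∀ o, m ≤ n o) {x : X}
    (hx : Φ x ∉ ball z s) : m * s ^ 2 / 16 ≤ deviance n f (Φ x) := by
  have hfar : s / 2 ≤ dist (Φ x) f := by
    have := dist_triangle (Φ x) f z
    rw [mem_ball] at hf hx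
    linarith
  have hdev := mul_dist_sq_le_deviance hf1 (fun o => h.mem x o (mem_univ o)) (hΦ0 x) hm0 hm
  have hsq : m * (s / 2) ^ 2 ≤ m * dist (Φ x) f ^ 2 := by gcongr
  linarith

variable {X κ ι : Type*} [NormedAddCommGroup X] [NormedSpace ℝ X] [FiniteDimensional ℝ X]
  [MeasurableSpace X] [BorelSpace X] (μ : Measure X) [μ.IsAddHaarMeasure] [Fintype κ] [Fintype ι]
  {Φ : X → κ → ι → ℝ} {Ψ : (κ → ι → ℝ) → X} {z f : κ → ι → ℝ} {r : ℝ} {L : ℝ≥0}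

-- Contracting towards `f` by one half halves the deviance and distorts volumes boundedly.
lemma setLIntegral_exp_half_deviance_le
    (h : IsLipschitzChart Φ Ψ (univ.pi fun _ => stdSimplex ℝ ι) z r L) (hΦ : Measurable Φ)
    (hΦ0 : ∀ x o j, 0 < Φ x o j) (hf : f ∈ ball z r) (hf1 : ∀ o, f o ∈ stdSimplex ℝ ι)
    (n : κ → ℕ) :
    ∫⁻ x in Φ ⁻¹' ball z r, ENNReal.ofReal (Real.exp (-(deviance n f (Φ x) / 2))) ∂μ ≤
      ((2 * L ^ 2 : ℝ≥0) : ℝ≥0∞) ^ Module.finrank ℝ X *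
        ∫⁻ x in Φ ⁻¹' ball z r, ENNReal.ofReal (Real.exp (-deviance n f (Φ x))) ∂μ := by
  have hP : Convex ℝ (univ.pi fun _ : κ => stdSimplex ℝ ι) :=
    convex_pi fun _ _ => convex_stdSimplex ℝ ι
  have hfP : f ∈ ball z r ∩ univ.pi fun _ => stdSimplex ℝ ι := ⟨hf, fun o _ => hf1 o⟩
  refine setLIntegral_le_mul_setLIntegral_of_le_comp μ (hΦ measurableSet_ball)
    (h.mapsTo_midpoint hP hfP) (fun x hx y hy => h.dist_le_mul_dist_midpoint hP hfP hx hy)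
    (by fun_prop) (by fun_prop) (fun x => (Real.exp_pos _).le) (fun x => (Real.exp_pos _).le)
    fun x hx => Real.exp_le_exp.2 ?_
  rw [h.apply_midpoint hP hfP hx]
  linarith [two_mul_deviance_midpoint_le (n := n) (fun o => (hf1 o).1) (hΦ0 x)]

lemma exists_lintegral_deviance_le {x₀ : X}
    (h : IsLipschitzChart Φ Ψ (univ.pi fun _ => stdSimplex ℝ ι) (Φ x₀) r L) (hr : 0 < r)
    (hΦ : Continuous Φ) (hΦ0 : ∀ x o j, 0 < Φ x o j) {π : X → ℝ≥0∞} (hπ : Measurable π)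
    (hπ1 : ∫⁻ x, π x ∂μ ≤ 1) (hπc : ContinuousAt π x₀) (hπ0 : π x₀ ≠ 0) (hπt : π x₀ ≠ ∞)
    {ρ : ℝ} (hρ : 0 < ρ) :
    ∃ ε > 0, ∃ N₀ : ℕ, ∀ n : κ → ℕ, N₀ ≤ ∑ o, n o → (∀ o, ρ * ∑ o, (n o : ℝ) ≤ n o) →
      ∀ f ∈ ball (Φ x₀) ε, (∀ o, f o ∈ stdSimplex ℝ ι) →
        (∫⁻ x, ENNReal.ofReal (Real.exp (-deviance n f (Φ x))) * π x ∂μ) ≠ 0 ∧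
        ∫⁻ x, ENNReal.ofReal (deviance n f (Φ x) * Real.exp (-deviance n f (Φ x))) * π x ∂μ ≤
          (4 * ((2 * L ^ 2 : ℝ≥0) : ℝ≥0∞) ^ Module.finrank ℝ X + 1) *
            ∫⁻ x, ENNReal.ofReal (Real.exp (-deviance n f (Φ x))) * π x ∂μ := by
  set a := π x₀ / 2
  have hnear : ∀ᶠ x in 𝓝 x₀, a ≤ π x ∧ π x ≤ 4 * a := by
    refine (hπc.eventually_const_le (ENNReal.half_lt_self hπ0 hπt)).and
      (hπc.eventually_le_const ?_)
    rw [show 4 * a = π x₀ + π x₀ by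
      rw [← ENNReal.add_halves (π x₀)]
      ring]
    exact ENNReal.lt_add_right hπt hπ0
  obtain ⟨t, ht, hball⟩ := Metric.eventually_nhds_iff_ball.1
    (h.eventually_forall_of_eventually hr hnear)
  have hs : 0 < min r t := lt_min hr ht
  set s := min r t
  obtain ⟨ε, hε, N₀, hev⟩ := exists_exp_neg_le_lintegral_exp_neg_deviance (μ := μ) hΦ.measurable
    hΦ.continuousAt (fun o j => (hΦ0 x₀ o j).ne') hπ hπc hπ0
    (show 0 < ρ * s ^ 2 / 32 by positivity)
  refine ⟨min ε (s / 2), by positivity, N₀, fun n hn hρn f hf hf1 => ?_⟩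
  have hfs : f ∈ ball (Φ x₀) (s / 2) := ball_subset_ball (min_le_right _ _) hf
  have hevn := hev n hn f (ball_subset_ball (min_le_left _ _) hf)
  have hUπ (x : X) (hx : Φ x ∈ ball (Φ x₀) s) : a ≤ π x ∧ π x ≤ 4 * a :=
    hball _ (ball_subset_ball (min_le_right _ _) hx) x rfl
  refine ⟨((ENNReal.ofReal_pos.2 (Real.exp_pos _)).trans_le hevn).ne', ?_⟩
  refine lintegral_mul_exp_neg_mul_le (U := Φ ⁻¹' ball (Φ x₀) s) (by fun_prop) hπ hπ1
    (hΦ.measurable measurableSet_ball) (fun x hx => (hUπ x hx).1) (fun x hx => (hUπ x hx).2)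
    ((h.mono (min_le_left _ _)).setLIntegral_exp_half_deviance_le μ hΦ.measurable hΦ0
      (ball_subset_ball (by linarith) hfs) hf1 n) (fun x hx => ?_) hevn
  have hdev := h.le_deviance_of_notMem_ball hΦ0 hs.le hfs hf1
    (mul_nonneg hρ.le (Finset.sum_nonneg fun o _ => Nat.cast_nonneg _)) hρn hx
  linarith

end IsLipschitzChart

/-! ### Quadratic forms on centred vectors -/

/-- The quadratic form `vᵀ L v` on centred vectors. -/
noncomputable def quadForm {K : ℕ} (L : Matrix (Fin K) (Fin K) ℝ) (v : centred K) : ℝ :=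
  ∑ i, ∑ j, (v : EuclideanSpace ℝ (Fin K)) i * L i j * (v : EuclideanSpace ℝ (Fin K)) j

/-- Positive definiteness of `vᵀ L v` on centred vectors, which makes the Gaussian Markov random
fields with precision `τ L` proper. -/
def IsPosDefOnCentred {K : ℕ} (L : Matrix (Fin K) (Fin K) ℝ) : Prop :=
  ∀ v : centred K, v ≠ 0 → 0 < quadForm L v

lemma exists_mul_sq_norm_le {E : Type*} [NormedAddCommGroup E] [NormedSpace ℝ E] [ProperSpace E]
    {Q : E → ℝ} (hQ : Continuous Q) (hsmul : ∀ (c : ℝ) v, Q (c • v) = c ^ 2 * Q v)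
    (hpos : ∀ v, v ≠ 0 → 0 < Q v) : ∃ m : ℝ, 0 < m ∧ ∀ v, m * ‖v‖ ^ 2 ≤ Q v := by
  have h0 : Q 0 = 0 := by simpa using hsmul 0 0
  rcases subsingleton_or_nontrivial E with hE | hE
  · exact ⟨1, one_pos, fun v => by simp [Subsingleton.elim v 0, h0]⟩
  obtain ⟨u, hu, hmin⟩ := (isCompact_sphere (0 : E) 1).exists_isMinOn
    (NormedSpace.sphere_nonempty.2 zero_le_one) hQ.continuousOn
  refine ⟨Q u, hpos u (ne_zero_of_mem_unit_sphere (⟨u, hu⟩ : sphere (0 : E) 1)), fun v => ?_⟩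
  rcases eq_or_ne v 0 with rfl | hv
  · simp [h0]
  have hunit : ‖v‖⁻¹ • v ∈ sphere (0 : E) 1 := by
    rw [mem_sphere_zero_iff_norm, norm_smul, norm_inv, norm_norm,
      inv_mul_cancel₀ (norm_ne_zero_iff.2 hv)]
  have hle : Q u ≤ Q (‖v‖⁻¹ • v) := hmin hunit
  have hv' := norm_pos_iff.2 hv
  rwa [hsmul, inv_pow, inv_mul_eq_div, le_div_iff₀ (by positivity)] at hle

section quadForm

variable {K : ℕ} (L : Matrix (Fin K) (Fin K) ℝ)

@[fun_prop]
lemma continuous_quadForm : Continuous (quadForm L) := by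
  unfold quadForm
  fun_prop

lemma quadForm_smul (c : ℝ) (v : centred K) : quadForm L (c • v) = c ^ 2 * quadForm L v := by
  simp only [quadForm, Finset.mul_sum, Submodule.coe_smul, PiLp.smul_apply, smul_eq_mul]
  exact Finset.sum_congr rfl fun i _ => Finset.sum_congr rfl fun j _ => by ring

variable {L}

lemma IsPosDefOnCentred.quadForm_nonneg (hL : IsPosDefOnCentred L) (v : centred K) :
    0 ≤ quadForm L v := by
  rcases eq_or_ne v 0 with rfl | hv
  · simp [quadForm]
  · exact (hL v hv).le

end quadForm

section laplacian

variable {K : ℕ} {W : Matrix (Fin K) (Fin K) ℝ}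

lemma sum_mul_laplacian_mul (hW : W.IsSymm) (x : Fin K → ℝ) :
    ∑ i, ∑ j, x i * laplacian W i j * x j = (∑ i, ∑ j, W i j * (x i - x j) ^ 2) / 2 := by
  have hlap : ∑ i, ∑ j, x i * laplacian W i j * x j =
      ∑ i, ∑ j, W i j * x i ^ 2 - ∑ i, ∑ j, x i * W i j * x j := by
    rw [← Finset.sum_sub_distrib]
    refine Finset.sum_congr rfl fun i _ => ?_
    have hterm (j : Fin K) : x i * laplacian W i j * x j =
        (if i = j then (∑ k, W i k) * x i ^ 2 else 0) - x i * W i j * x j := by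
      rw [laplacian, Matrix.sub_apply, Matrix.diagonal_apply]
      split_ifs with h
      · subst h
        ring
      · ring
    simp only [hterm, Finset.sum_sub_distrib, Finset.sum_ite_eq, Finset.mem_univ, if_true,
      Finset.sum_mul]
  have hswap : ∑ i, ∑ j, W i j * x j ^ 2 = ∑ i, ∑ j, W i j * x i ^ 2 := by
    rw [Finset.sum_comm]
    exact Finset.sum_congr rfl fun i _ => Finset.sum_congr rfl fun j _ => by rw [hW.apply]
  have hsquare : ∑ i, ∑ j, W i j * (x i - x j) ^ 2 =
      ∑ i, ∑ j, W i j * x i ^ 2 + ∑ i, ∑ j, W i j * x j ^ 2 -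
        2 * ∑ i, ∑ j, x i * W i j * x j := by
    simp only [Finset.mul_sum, ← Finset.sum_add_distrib, ← Finset.sum_sub_distrib]
    exact Finset.sum_congr rfl fun i _ => Finset.sum_congr rfl fun j _ => by ring
  rw [hlap, hsquare, hswap]
  ring

lemma IsConnectedLabelGraph.apply_eq_of_forall_weight_ne_zero {X : Type*}
    (hW : IsConnectedLabelGraph W) {x : Fin K → X} (hx : ∀ i j, W i j ≠ 0 → x i = x j)
    (i j : Fin K) : x i = x j := by
  obtain ⟨p⟩ := hW.connected.preconnected i j
  induction p with
  | nil => rfl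
  | cons hadj _ ih =>
    obtain ⟨_, hab | hba⟩ := (SimpleGraph.fromRel_adj _ _ _).1 hadj
    · exact (hx _ _ hab).trans ih
    · exact (hx _ _ hba).symm.trans ih

lemma eq_zero_of_forall_apply_eq {v : centred K}
    (hv : ∀ i j, (v : EuclideanSpace ℝ (Fin K)) i = (v : EuclideanSpace ℝ (Fin K)) j) : v = 0 := by
  ext i
  have hsum : ∑ j, (v : EuclideanSpace ℝ (Fin K)) j = 0 := v.2
  rw [Finset.sum_congr rfl fun j _ => hv j i, Finset.sum_const, Finset.card_univ,
    Fintype.card_fin, nsmul_eq_mul] at hsum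
  exact (mul_eq_zero.1 hsum).resolve_left (Nat.cast_ne_zero.2 (Fin.pos i).ne')

lemma IsConnectedLabelGraph.isPosDefOnCentred_laplacian (hW : IsConnectedLabelGraph W) :
    IsPosDefOnCentred (laplacian W) := by
  intro v hv
  set x : Fin K → ℝ := fun i => (v : EuclideanSpace ℝ (Fin K)) i
  have hquad : quadForm (laplacian W) v = (∑ i, ∑ j, W i j * (x i - x j) ^ 2) / 2 :=
    sum_mul_laplacian_mul hW.symm x
  have hterm (i j : Fin K) : 0 ≤ W i j * (x i - x j) ^ 2 :=
    mul_nonneg (hW.nonneg i j) (sq_nonneg _)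
  have hrow (i : Fin K) : 0 ≤ ∑ j, W i j * (x i - x j) ^ 2 :=
    Finset.sum_nonneg fun j _ => hterm i j
  rw [hquad]
  refine (div_nonneg (Finset.sum_nonneg fun i _ => hrow i) zero_le_two).lt_of_ne' fun h => hv ?_
  rw [div_eq_zero_iff, or_iff_left two_ne_zero,
    Finset.sum_eq_zero_iff_of_nonneg fun i _ => hrow i] at h
  refine eq_zero_of_forall_apply_eq (hW.apply_eq_of_forall_weight_ne_zero fun i j hij => ?_)
  have hzero := (Finset.sum_eq_zero_iff_of_nonneg fun j _ => hterm i j).1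
    (h i (Finset.mem_univ i)) j (Finset.mem_univ j)
  exact sub_eq_zero.1 (pow_eq_zero_iff two_ne_zero |>.1 ((mul_eq_zero.1 hzero).resolve_left hij))

end laplacian

/-! ### Gaussian Markov random fields -/

lemma integrable_exp_neg_mul_sq_norm {V : Type*} [NormedAddCommGroup V] [InnerProductSpace ℝ V]
    [FiniteDimensional ℝ V] [MeasurableSpace V] [BorelSpace V] {b : ℝ} (hb : 0 < b) :
    Integrable fun v : V => Real.exp (-b * ‖v‖ ^ 2) := by
  refine Integrable.of_integral_ne_zero ?_
  rw [GaussianFourier.integral_rexp_neg_mul_sq_norm hb]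
  positivity

lemma lintegral_pi_fin_prod_eq_pow {X : Type*} [MeasurableSpace X] (μ : Measure X) [SigmaFinite μ]
    {f : X → ℝ≥0∞} (hf : Measurable f) (n : ℕ) :
    ∫⁻ x : Fin n → X, ∏ i, f (x i) ∂(Measure.pi fun _ => μ) = (∫⁻ x, f x ∂μ) ^ n := by
  induction n with
  | zero => simp
  | succ n ih =>
    have hprod : Measurable fun x : Fin n → X => ∏ i, f (x i) := by fun_prop
    rw [← (measurePreserving_piFinSuccAbove (fun _ : Fin (n + 1) => μ) 0).symm.lintegral_comp
      (by fun_prop)]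
    simp only [MeasurableEquiv.piFinSuccAbove_symm_apply, Fin.insertNthEquiv_zero,
      Fin.consEquiv_apply, Fin.prod_univ_succ, Fin.cons_zero, Fin.cons_succ, pow_succ']
    rw [lintegral_prod_mul hf.aemeasurable hprod.aemeasurable, ih]

lemma centredLebesgue_eq_volume (K : ℕ) : centredLebesgue K = volume :=
  (stdOrthonormalBasis ℝ (centred K)).addHaar_eq_volume

instance (K : ℕ) : (centredLebesgue K).IsAddHaarMeasure :=
  inferInstanceAs (stdOrthonormalBasis ℝ (centred K)).toBasis.addHaar.IsAddHaarMeasure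

/-- The normalising constant of the Gaussian Markov random field with precision `τ L`. -/
noncomputable def gmrfConst {K : ℕ} (L : Matrix (Fin K) (Fin K) ℝ) (τ : ℝ) : ℝ≥0∞ :=
  ∫⁻ w, gmrfWeight L τ w ∂(centredLebesgue K)

section gmrf

variable {K : ℕ} (L : Matrix (Fin K) (Fin K) ℝ)

lemma gmrfWeight_eq (τ : ℝ) (v : centred K) :
    gmrfWeight L τ v = ENNReal.ofReal (Real.exp (-(τ / 2) * quadForm L v)) := rfl

@[fun_prop]
lemma measurable_gmrfWeight : Measurable fun p : ℝ × centred K => gmrfWeight L p.1 p.2 := by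
  simp only [gmrfWeight_eq]
  have := (continuous_quadForm L).measurable
  fun_prop

@[fun_prop]
lemma measurable_gmrfConst : Measurable (gmrfConst L) :=
  (measurable_gmrfWeight L).lintegral_prod_right'

lemma gmrfDensity_eq (τ : ℝ) (v : centred K) :
    gmrfDensity L τ v = (gmrfConst L τ)⁻¹ * gmrfWeight L τ v :=
  ENNReal.div_eq_inv_mul

@[fun_prop]
lemma measurable_gmrfDensity : Measurable fun p : ℝ × centred K => gmrfDensity L p.1 p.2 := by
  simp only [gmrfDensity_eq]
  fun_prop

lemma prod_gmrfDensity_eq {ι : Type*} [Fintype ι] (τ : ℝ) (φ : ι → centred K) :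
    ∏ i, gmrfDensity L τ (φ i) = (gmrfConst L τ)⁻¹ ^ Fintype.card ι *
      ENNReal.ofReal (Real.exp (-(τ / 2) * ∑ i, quadForm L (φ i))) := by
  simp only [gmrfDensity_eq, gmrfWeight_eq]
  rw [Finset.prod_mul_distrib, Finset.prod_const, Finset.card_univ, Finset.mul_sum, Real.exp_sum,
    ENNReal.ofReal_prod_of_nonneg fun _ _ => (Real.exp_pos _).le]

lemma lintegral_gmrfDensity_le_one (τ : ℝ) :
    ∫⁻ v, gmrfDensity L τ v ∂(centredLebesgue K) ≤ 1 := by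
  simp only [gmrfDensity_eq]
  rw [lintegral_const_mul _ (by fun_prop), mul_comm]
  exact ENNReal.div_self_le_one

lemma gmrfConst_ne_zero (τ : ℝ) : gmrfConst L τ ≠ 0 := by
  refine (lintegral_pos_iff_support (by fun_prop) |>.2 ?_).ne'
  have hsupp : Function.support (gmrfWeight L τ) = univ := eq_univ_of_forall fun v => by
    rw [Function.mem_support, gmrfWeight_eq]
    exact (ENNReal.ofReal_pos.2 (Real.exp_pos _)).ne'
  rw [hsupp]
  exact Measure.measure_univ_pos.2 (NeZero.ne _)

lemma gmrfConst_eq {τ : ℝ} (hτ : 0 < τ) :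
    gmrfConst L τ = ENNReal.ofReal ((√τ ^ Module.finrank ℝ (centred K))⁻¹) * gmrfConst L 1 := by
  have hs := Real.sqrt_pos.2 hτ
  have hscale (v : centred K) : gmrfWeight L τ v = gmrfWeight L 1 (√τ • v) := by
    rw [gmrfWeight_eq, gmrfWeight_eq, quadForm_smul, Real.sq_sqrt hτ.le]
    congr 2
    ring
  rw [gmrfConst, lintegral_congr hscale, ← lintegral_map (by fun_prop) (measurable_const_smul _),
    Measure.map_addHaar_smul _ hs.ne', lintegral_smul_measure, smul_eq_mul,
    abs_of_pos (by positivity), gmrfConst]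

lemma inv_gmrfConst_eq {τ : ℝ} (hτ : 0 < τ) :
    (gmrfConst L τ)⁻¹ =
      ENNReal.ofReal (√τ) ^ Module.finrank ℝ (centred K) * (gmrfConst L 1)⁻¹ := by
  have hs := Real.sqrt_pos.2 hτ
  rw [gmrfConst_eq L hτ, ENNReal.mul_inv (Or.inl (by positivity)) (Or.inl ENNReal.ofReal_ne_top),
    ENNReal.ofReal_inv_of_pos (by positivity), inv_inv, ENNReal.ofReal_pow hs.le]

variable {L}

lemma IsPosDefOnCentred.gmrfConst_ne_top (hL : IsPosDefOnCentred L) {τ : ℝ} (hτ : 0 < τ) :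
    gmrfConst L τ ≠ ∞ := by
  obtain ⟨m, hm, hle⟩ := exists_mul_sq_norm_le (continuous_quadForm L) (quadForm_smul L) hL
  have hint : Integrable (fun v => Real.exp (-(τ / 2) * quadForm L v)) (centredLebesgue K) := by
    rw [centredLebesgue_eq_volume]
    refine (integrable_exp_neg_mul_sq_norm (V := centred K)
      (show 0 < τ / 2 * m by positivity)).mono' (by fun_prop) (ae_of_all _ fun v => ?_)
    rw [Real.norm_eq_abs, abs_of_pos (Real.exp_pos _)]
    refine Real.exp_le_exp.2 ?_
    nlinarith [mul_le_mul_of_nonneg_left (hle v) (half_pos hτ).le]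
  exact hint.lintegral_lt_top.ne

end gmrf

/-! ### Hyperpriors -/

/-- A hyperprior for the precision `τ`: a law on the positive reals with finite moments of all
half-integer orders, which make the scale mixtures of Gaussian densities finite. -/
structure IsHyperprior (π : Measure ℝ) : Prop where
  prob : IsProbabilityMeasure π
  pos : ∀ᵐ τ ∂π, 0 < τ
  moment : ∀ m : ℕ, ∫⁻ τ, ENNReal.ofReal (√τ) ^ m ∂π ≠ ∞

lemma isHyperprior_dirac {τ : ℝ} (hτ : 0 < τ) : IsHyperprior (Measure.dirac τ) where
  prob := inferInstance
  pos := by simpa [ae_dirac_eq] using hτ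
  moment m := by simp

lemma measurable_gammaPDF (a b : ℝ) : Measurable (gammaPDF a b) :=
  (measurable_gammaPDFReal a b).ennreal_ofReal

lemma ae_pos_gammaMeasure (a b : ℝ) : ∀ᵐ τ ∂(gammaMeasure a b), 0 < τ := by
  rw [gammaMeasure, ae_withDensity_iff (measurable_gammaPDF a b)]
  filter_upwards [Measure.ae_ne volume 0] with τ hτ hd
  by_contra hneg
  exact hd (gammaPDF_of_neg ((not_lt.1 hneg).lt_of_ne hτ))

lemma gammaPDF_mul_sqrt_pow {a b : ℝ} (ha : 0 < a) (hb : 0 < b) (m : ℕ) {τ : ℝ} (hτ : τ ≠ 0) :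
    gammaPDF a b τ * ENNReal.ofReal (√τ) ^ m =
      ENNReal.ofReal (b ^ a / Real.Gamma a / (b ^ (a + m / 2) / Real.Gamma (a + m / 2))) *
        gammaPDF (a + m / 2) b τ := by
  rcases lt_or_gt_of_ne hτ with hτ | hτ
  · rw [gammaPDF_of_neg hτ, gammaPDF_of_neg hτ, zero_mul, mul_zero]
  have := Real.Gamma_pos_of_pos ha
  have := Real.Gamma_pos_of_pos (show 0 < a + (m : ℝ) / 2 by positivity)
  have hsqrt : √τ ^ m = τ ^ ((m : ℝ) / 2) := by
    rw [Real.sqrt_eq_rpow, ← Real.rpow_natCast, ← Real.rpow_mul hτ.le, one_div_mul_eq_div]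
  rw [gammaPDF_of_nonneg hτ.le, gammaPDF_of_nonneg hτ.le,
    ← ENNReal.ofReal_pow (Real.sqrt_nonneg _), ← ENNReal.ofReal_mul (by positivity),
    ← ENNReal.ofReal_mul (by positivity), hsqrt,
    show a + (m : ℝ) / 2 - 1 = a - 1 + m / 2 by ring, Real.rpow_add hτ]
  congr 1
  field_simp

lemma isHyperprior_gammaMeasure {a b : ℝ} (ha : 0 < a) (hb : 0 < b) :
    IsHyperprior (gammaMeasure a b) where
  prob := isProbabilityMeasure_gammaMeasure ha hb
  pos := ae_pos_gammaMeasure a b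
  moment m := by
    rw [gammaMeasure, lintegral_withDensity_eq_lintegral_mul _ (measurable_gammaPDF a b)
      (by fun_prop)]
    simp only [Pi.mul_apply]
    rw [lintegral_congr_ae ((Measure.ae_ne volume 0).mono fun τ hτ =>
      gammaPDF_mul_sqrt_pow ha hb m hτ), lintegral_const_mul _ (measurable_gammaPDF _ b),
      lintegral_gammaPDF_eq_one (by positivity) hb, mul_one]
    exact ENNReal.ofReal_ne_top

lemma IsFixedOrGamma.isHyperprior {π : Measure ℝ} (h : IsFixedOrGamma π) : IsHyperprior π := by
  obtain ⟨τ, hτ, rfl⟩ | ⟨a, b, ha, hb, rfl⟩ := h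
  exacts [isHyperprior_dirac hτ, isHyperprior_gammaMeasure ha hb]

/-! ### The marginal prior density of the log-odds -/

/-- The joint density of a family of Gaussian Markov random fields that are independent given
their common precision parameter `τ ∼ π`. -/
noncomputable def gmrfMixture {K : ℕ} (L : Matrix (Fin K) (Fin K) ℝ) (π : Measure ℝ) {ι : Type*}
    [Fintype ι] (φ : ι → centred K) : ℝ≥0∞ :=
  ∫⁻ τ, ∏ i, gmrfDensity L τ (φ i) ∂π

/-- The marginal prior density of the log-odds. -/
noncomputable def logOddsDensity {K : ℕ} (L : Matrix (Fin K) (Fin K) ℝ) (πq πC : Measure ℝ)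
    (x : LogOdds K) : ℝ≥0∞ :=
  gmrfMixture L πq (fun _ : Unit => x.1) * gmrfMixture L πC x.2

/-- Lebesgue measure on the log-odds. -/
noncomputable def logOddsLebesgue (K : ℕ) : Measure (LogOdds K) :=
  (centredLebesgue K).prod (Measure.pi fun _ : Fin K => centredLebesgue K)

instance (K : ℕ) : (logOddsLebesgue K).IsAddHaarMeasure :=
  Measure.prod.instIsAddHaarMeasure _ _

lemma lintegral_lintegral_le_one {X Y : Type*} [MeasurableSpace X] [MeasurableSpace Y]
    {μ : Measure X} {π : Measure Y} [SFinite μ] [IsProbabilityMeasure π] {f : Y × X → ℝ≥0∞}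
    (hf : Measurable f) (h : ∀ y, ∫⁻ x, f (y, x) ∂μ ≤ 1) :
    ∫⁻ x, ∫⁻ y, f (y, x) ∂π ∂μ ≤ 1 := by
  rw [lintegral_lintegral_swap (f := fun x y => f (y, x)) (hf.comp measurable_swap).aemeasurable]
  exact (lintegral_mono h).trans (by simp)

section gmrfMixture

variable {K : ℕ} {L : Matrix (Fin K) (Fin K) ℝ} {π : Measure ℝ} {ι : Type*} [Fintype ι]

lemma measurable_prod_gmrfDensity (L : Matrix (Fin K) (Fin K) ℝ) :
    Measurable fun p : ℝ × (ι → centred K) => ∏ i, gmrfDensity L p.1 (p.2 i) := by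
  have := (continuous_quadForm L).measurable
  simp only [prod_gmrfDensity_eq]
  fun_prop

@[fun_prop]
lemma measurable_gmrfMixture [SFinite π] :
    Measurable fun φ : ι → centred K => gmrfMixture L π φ :=
  (measurable_prod_gmrfDensity L).lintegral_prod_left'

lemma lintegral_gmrfMixture_unit_le_one [IsProbabilityMeasure π] :
    ∫⁻ v, gmrfMixture L π (fun _ : Unit => v) ∂(centredLebesgue K) ≤ 1 := by
  simp only [gmrfMixture, Finset.univ_unique, Finset.prod_singleton]
  exact lintegral_lintegral_le_one (measurable_gmrfDensity L) (lintegral_gmrfDensity_le_one L)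

lemma lintegral_gmrfMixture_fin_le_one [IsProbabilityMeasure π] (n : ℕ) :
    ∫⁻ φ : Fin n → centred K, gmrfMixture L π φ ∂(Measure.pi fun _ => centredLebesgue K) ≤ 1 :=
  lintegral_lintegral_le_one (measurable_prod_gmrfDensity L) fun τ => by
    dsimp only
    rw [lintegral_pi_fin_prod_eq_pow _ (f := gmrfDensity L τ) (by fun_prop)]
    exact pow_le_one' (lintegral_gmrfDensity_le_one L τ) n

lemma IsHyperprior.lintegral_inv_gmrfConst_pow_ne_top (hπ : IsHyperprior π)
    (L : Matrix (Fin K) (Fin K) ℝ) (k : ℕ) : ∫⁻ τ, (gmrfConst L τ)⁻¹ ^ k ∂π ≠ ∞ := by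
  have hpow : ∀ᵐ τ ∂π, (gmrfConst L τ)⁻¹ ^ k =
      ENNReal.ofReal (√τ) ^ (Module.finrank ℝ (centred K) * k) * (gmrfConst L 1)⁻¹ ^ k := by
    filter_upwards [hπ.pos] with τ hτ
    rw [inv_gmrfConst_eq L hτ, mul_pow, pow_mul]
  rw [lintegral_congr_ae hpow, lintegral_mul_const _ (by fun_prop)]
  exact ENNReal.mul_ne_top (hπ.moment _)
    (ENNReal.pow_ne_top (ENNReal.inv_ne_top.2 (gmrfConst_ne_zero L 1)))

lemma IsPosDefOnCentred.prod_gmrfDensity_le (hL : IsPosDefOnCentred L) {τ : ℝ} (hτ : 0 < τ)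
    (φ : ι → centred K) :
    ∏ i, gmrfDensity L τ (φ i) ≤ (gmrfConst L τ)⁻¹ ^ Fintype.card ι := by
  rw [prod_gmrfDensity_eq]
  refine mul_le_of_le_one_right' (ENNReal.ofReal_le_one.2 (Real.exp_le_one_iff.2 ?_))
  have := Finset.sum_nonneg fun i (_ : i ∈ Finset.univ) => hL.quadForm_nonneg (φ i)
  nlinarith

lemma IsHyperprior.gmrfMixture_ne_top (hπ : IsHyperprior π) (hL : IsPosDefOnCentred L)
    (φ : ι → centred K) : gmrfMixture L π φ ≠ ∞ := by
  refine ne_top_of_le_ne_top (hπ.lintegral_inv_gmrfConst_pow_ne_top L (Fintype.card ι))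
    (lintegral_mono_ae ?_)
  filter_upwards [hπ.pos] with τ hτ
  exact hL.prod_gmrfDensity_le hτ φ

lemma IsHyperprior.gmrfMixture_ne_zero (hπ : IsHyperprior π) (hL : IsPosDefOnCentred L)
    (φ : ι → centred K) : gmrfMixture L π φ ≠ 0 := by
  have := hπ.prob
  have hpos : ∀ᵐ τ ∂π, ∏ i, gmrfDensity L τ (φ i) ≠ 0 := by
    filter_upwards [hπ.pos] with τ hτ
    rw [prod_gmrfDensity_eq]
    exact mul_ne_zero (pow_ne_zero _ (ENNReal.inv_ne_zero.2 (hL.gmrfConst_ne_top hτ)))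
      (ENNReal.ofReal_pos.2 (Real.exp_pos _)).ne'
  rw [gmrfMixture, Ne, lintegral_eq_zero_iff (by fun_prop)]
  intro hzero
  obtain ⟨τ, hτ, hτ'⟩ := (hzero.and hpos).exists
  exact hτ' hτ

lemma IsHyperprior.continuous_gmrfMixture (hπ : IsHyperprior π) (hL : IsPosDefOnCentred L) :
    Continuous fun φ : ι → centred K => gmrfMixture L π φ := by
  refine continuous_iff_continuousAt.2 fun φ => ?_
  refine tendsto_lintegral_filter_of_dominated_convergence
    (fun τ => (gmrfConst L τ)⁻¹ ^ Fintype.card ι)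
    (Filter.Eventually.of_forall fun ψ => by fun_prop)
    (Filter.Eventually.of_forall fun ψ => ?_) (hπ.lintegral_inv_gmrfConst_pow_ne_top L _)
    (ae_of_all _ fun τ => ?_)
  · filter_upwards [hπ.pos] with τ hτ
    exact hL.prod_gmrfDensity_le hτ ψ
  · simp only [prod_gmrfDensity_eq]
    exact ENNReal.Tendsto.const_mul ((ENNReal.continuous_ofReal.comp (by fun_prop)).tendsto φ)
      (Or.inr (ENNReal.pow_ne_top (ENNReal.inv_ne_top.2 (gmrfConst_ne_zero L τ))))

end gmrfMixture

section logOddsDensity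

variable {K : ℕ} {L : Matrix (Fin K) (Fin K) ℝ} {πq πC : Measure ℝ}

lemma continuous_logOddsDensity (hL : IsPosDefOnCentred L) (hq : IsHyperprior πq)
    (hC : IsHyperprior πC) : Continuous (logOddsDensity L πq πC) := by
  have htheta : Continuous fun x : LogOdds K => gmrfMixture L πq fun _ : Unit => x.1 :=
    (hq.continuous_gmrfMixture hL).comp (by fun_prop)
  have hphi : Continuous fun x : LogOdds K => gmrfMixture L πC x.2 :=
    (hC.continuous_gmrfMixture hL).comp continuous_snd
  exact continuous_iff_continuousAt.2 fun x => ENNReal.Tendsto.mul htheta.continuousAt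
    (Or.inr (hC.gmrfMixture_ne_top hL _)) hphi.continuousAt (Or.inr (hq.gmrfMixture_ne_top hL _))

lemma logOddsDensity_ne_zero (hL : IsPosDefOnCentred L) (hq : IsHyperprior πq)
    (hC : IsHyperprior πC) (x : LogOdds K) : logOddsDensity L πq πC x ≠ 0 :=
  mul_ne_zero (hq.gmrfMixture_ne_zero hL _) (hC.gmrfMixture_ne_zero hL _)

lemma logOddsDensity_ne_top (hL : IsPosDefOnCentred L) (hq : IsHyperprior πq)
    (hC : IsHyperprior πC) (x : LogOdds K) : logOddsDensity L πq πC x ≠ ∞ :=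
  ENNReal.mul_ne_top (hq.gmrfMixture_ne_top hL _) (hC.gmrfMixture_ne_top hL _)

lemma lintegral_logOddsDensity_le_one [IsProbabilityMeasure πq] [IsProbabilityMeasure πC] :
    ∫⁻ x, logOddsDensity L πq πC x ∂(logOddsLebesgue K) ≤ 1 := by
  have htheta : Measurable fun v : centred K => gmrfMixture L πq fun _ : Unit => v :=
    measurable_gmrfMixture.comp (by fun_prop)
  simp only [logOddsDensity, logOddsLebesgue]
  rw [lintegral_prod_mul htheta.aemeasurable measurable_gmrfMixture.aemeasurable]
  exact mul_le_one' lintegral_gmrfMixture_unit_le_one (lintegral_gmrfMixture_fin_le_one K)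

lemma lintegral_prod_prod_mul {A B A' B' : Type*} [MeasurableSpace A] [MeasurableSpace B]
    [MeasurableSpace A'] [MeasurableSpace B'] (α : Measure A) (β : Measure B) (α' : Measure A')
    (β' : Measure B') [SFinite α] [SFinite β] [SFinite α'] [SFinite β'] {f : A × B → ℝ≥0∞}
    {f' : A' × B' → ℝ≥0∞} {g : B × B' → ℝ≥0∞} (hf : Measurable f) (hf' : Measurable f')
    (hg : Measurable g) :
    ∫⁻ x : (A × B) × (A' × B'), f x.1 * f' x.2 * g (x.1.2, x.2.2)
        ∂((α.prod β).prod (α'.prod β')) =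
      ∫⁻ y, g y * ((∫⁻ a, f (a, y.1) ∂α) * ∫⁻ a, f' (a, y.2) ∂α') ∂(β.prod β') := by
  have : Measurable fun b => ∫⁻ a, f (a, b) ∂α := hf.lintegral_prod_left'
  have hF' : Measurable fun b => ∫⁻ a, f' (a, b) ∂α' := hf'.lintegral_prod_left'
  have hinner (p : A × B) : ∫⁻ y, f p * f' y * g (p.2, y.2) ∂(α'.prod β') =
      f p * ∫⁻ b, (∫⁻ a, f' (a, b) ∂α') * g (p.2, b) ∂β' := by
    simp only [mul_assoc]
    rw [lintegral_const_mul _ (by fun_prop), lintegral_prod_symm' _ (by fun_prop)]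
    congr 1
    refine lintegral_congr fun b => ?_
    dsimp only
    rw [lintegral_mul_const _ (by fun_prop)]
  have : Measurable fun b => ∫⁻ b', (∫⁻ a, f' (a, b') ∂α') * g (b, b') ∂β' :=
    Measurable.lintegral_prod_right' (f := fun y : B × B' => (∫⁻ a, f' (a, y.2) ∂α') * g y)
      ((hF'.comp measurable_snd).mul hg)
  rw [lintegral_prod _ (by fun_prop)]
  simp only [hinner]
  rw [lintegral_prod_symm' _ (by fun_prop), lintegral_prod _ (by fun_prop)]
  refine lintegral_congr fun b => ?_
  dsimp only
  rw [lintegral_mul_const _ (by fun_prop), ← lintegral_const_mul _ (by fun_prop)]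
  refine lintegral_congr fun b' => ?_
  ring

lemma lintegral_prior [SFinite πq] [SFinite πC] {g : LogOdds K → ℝ≥0∞} (hg : Measurable g) :
    ∫⁻ x, g (x.1.2, x.2.2) ∂(prior L πq πC) =
      ∫⁻ x, g x * logOddsDensity L πq πC x ∂(logOddsLebesgue K) := by
  have hdensity : Measurable fun x : Param K => gmrfDensity L x.1.1 x.1.2 *
      ∏ i, gmrfDensity L x.2.1 (x.2.2 i) :=
    ((measurable_gmrfDensity L).comp measurable_fst).mul
      ((measurable_prod_gmrfDensity L).comp measurable_snd)
  rw [prior, lintegral_withDensity_eq_lintegral_mul _ hdensity (by fun_prop)]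
  refine (lintegral_prod_prod_mul πq (centredLebesgue K) πC
    (Measure.pi fun _ : Fin K => centredLebesgue K) (measurable_gmrfDensity L)
    (measurable_prod_gmrfDensity L) hg).trans ?_
  simp only [logOddsLebesgue, logOddsDensity, gmrfMixture, Finset.univ_unique,
    Finset.prod_singleton]

end logOddsDensity

/-! ### The algebraic connectivity -/

section lambda2

variable {K : ℕ} {W : Matrix (Fin K) (Fin K) ℝ}

lemma laplacian_apply_self (i : Fin K) :
    laplacian W i i = ∑ j ∈ Finset.univ.erase i, W i j := by
  rw [laplacian, Matrix.sub_apply, Matrix.diagonal_apply_eq,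
    ← Finset.sum_erase_add _ _ (Finset.mem_univ i), add_sub_cancel_right]

lemma laplacian_apply_of_ne {i j : Fin K} (hij : i ≠ j) : laplacian W i j = -W i j := by
  rw [laplacian, Matrix.sub_apply, Matrix.diagonal_apply_ne _ hij, zero_sub]

lemma isHermitian_laplacian (hW : W.IsSymm) : (laplacian W).IsHermitian :=
  (Matrix.isHermitian_diagonal _).sub hW

namespace IsConnectedLabelGraph

lemma laplacian_apply_self_le (hW : IsConnectedLabelGraph W) (i : Fin K) :
    laplacian W i i ≤ K := by
  rw [laplacian_apply_self]
  calc ∑ j ∈ Finset.univ.erase i, W i j ≤ ∑ _j ∈ Finset.univ.erase i, (1 : ℝ) :=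
        Finset.sum_le_sum fun j _ => hW.le_one i j
    _ ≤ ∑ _j : Fin K, (1 : ℝ) :=
        Finset.sum_le_sum_of_subset_of_nonneg (Finset.erase_subset _ _) fun _ _ _ => zero_le_one
    _ = K := by simp

lemma exists_ne_weight_ne_zero (hW : IsConnectedLabelGraph W) (hK : 2 ≤ K) :
    ∃ i j, i ≠ j ∧ W i j ≠ 0 := by
  have : Nontrivial (Fin K) := Fin.nontrivial_iff_two_le.2 hK
  obtain ⟨j, hj⟩ := hW.connected.preconnected.exists_adj_of_nontrivial (⟨0, by omega⟩ : Fin K)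
  obtain ⟨hne, h | h⟩ := (SimpleGraph.fromRel_adj _ _ _).1 hj
  exacts [⟨_, _, hne, h⟩, ⟨_, _, hne.symm, h⟩]

lemma trace_laplacian_pos (hW : IsConnectedLabelGraph W) (hK : 2 ≤ K) :
    0 < (laplacian W).trace := by
  obtain ⟨i, j, hij, hweight⟩ := hW.exists_ne_weight_ne_zero hK
  refine Finset.sum_pos' (fun k _ => ?_) ⟨i, Finset.mem_univ i, ?_⟩ <;>
    rw [Matrix.diag_apply, laplacian_apply_self]
  · exact Finset.sum_nonneg fun l _ => hW.nonneg k l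
  · exact Finset.sum_pos' (fun l _ => hW.nonneg i l)
      ⟨j, Finset.mem_erase.2 ⟨hij.symm, Finset.mem_univ j⟩, (hW.nonneg i j).lt_of_ne' hweight⟩

-- Gershgorin: the off-diagonal absolute row sums of a Laplacian equal its diagonal entries.
lemma eigenvalue_laplacian_le (hW : IsConnectedLabelGraph W) {l : ℝ}
    (hl : Module.End.HasEigenvalue (Matrix.toLin' (laplacian W)) l) : l ≤ 2 * K := by
  obtain ⟨i, hi⟩ := eigenvalue_mem_ball hl
  have hrow : ∑ j ∈ Finset.univ.erase i, ‖laplacian W i j‖ = laplacian W i i := by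
    rw [laplacian_apply_self]
    refine Finset.sum_congr rfl fun j hj => ?_
    rw [laplacian_apply_of_ne (Finset.ne_of_mem_erase hj).symm, norm_neg, Real.norm_eq_abs,
      abs_of_nonneg (hW.nonneg i j)]
  rw [hrow] at hi
  linarith [(abs_le.1 (mem_closedBall_iff_norm.1 hi)).2, hW.laplacian_apply_self_le i]

lemma exists_pos_eigenvalue_laplacian (hW : IsConnectedLabelGraph W) (hK : 2 ≤ K) :
    ∃ l : ℝ, 0 < l ∧ Module.End.HasEigenvalue (Matrix.toLin' (laplacian W)) l := by
  have hH := isHermitian_laplacian hW.symm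
  have htrace := hW.trace_laplacian_pos hK
  rw [hH.trace_eq_sum_eigenvalues] at htrace
  obtain ⟨i, _, hi⟩ := Finset.exists_lt_of_sum_lt (s := Finset.univ) (f := fun _ => (0 : ℝ))
    (g := hH.eigenvalues) (by simpa using htrace)
  refine ⟨hH.eigenvalues i, hi, ?_⟩
  rw [Module.End.hasEigenvalue_iff_mem_spectrum, Matrix.spectrum_toLin']
  exact hH.eigenvalues_mem_spectrum_real i

lemma lambda2_laplacian_mem (hW : IsConnectedLabelGraph W) (hK : 2 ≤ K) :
    lambda2 (laplacian W) ∈ Ioc (0 : ℝ) (2 * K) := by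
  have hfin : {l : ℝ | 0 < l ∧ Module.End.HasEigenvalue (Matrix.toLin' (laplacian W)) l}.Finite :=
    (Module.End.finite_hasEigenvalue (Matrix.toLin' (laplacian W))).subset fun l hl => hl.2
  obtain ⟨hpos, heig⟩ := Set.Nonempty.csInf_mem (hW.exists_pos_eigenvalue_laplacian hK) hfin
  exact ⟨hpos, hW.eigenvalue_laplacian_le heig⟩

lemma div_le_div_lambda2 (hW : IsConnectedLabelGraph W) (hK : 2 ≤ K) {B c : ℝ} (hB : 0 ≤ B)
    (hc : 0 ≤ c) : B / c ≤ B * (2 * K) / (lambda2 (laplacian W) * c) := by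
  obtain ⟨hpos, hle⟩ := hW.lambda2_laplacian_mem hK
  calc B / c = B * lambda2 (laplacian W) / (lambda2 (laplacian W) * c) := by
        rw [mul_comm B, mul_div_mul_left _ _ hpos.ne']
    _ ≤ B * (2 * K) / (lambda2 (laplacian W) * c) := by gcongr

end IsConnectedLabelGraph

end lambda2

/-! ### The posterior -/

lemma isProbabilityMeasure_inv_smul {Ω : Type*} [MeasurableSpace Ω] {ν : Measure Ω}
    (hν0 : ν univ ≠ 0) (hνt : ν univ ≠ ∞) : IsProbabilityMeasure ((ν univ)⁻¹ • ν) :=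
  ⟨by rw [Measure.smul_apply, smul_eq_mul, ENNReal.inv_mul_cancel hν0 hνt]⟩

lemma variance_inv_smul_le {Ω : Type*} [MeasurableSpace Ω] {ν : Measure Ω} {X : Ω → ℝ}
    (hX : AEMeasurable X ν) {a b : ℝ} (hb : 0 ≤ b) (hν0 : ν univ ≠ 0) (hνt : ν univ ≠ ∞)
    (h : ∫⁻ ω, ENNReal.ofReal ((X ω - a) ^ 2) ∂ν ≤ ENNReal.ofReal b * ν univ) :
    variance X ((ν univ)⁻¹ • ν) ≤ b := by
  have := isProbabilityMeasure_inv_smul hν0 hνt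
  have hX' : AEMeasurable X ((ν univ)⁻¹ • ν) := hX.smul_measure _
  rw [← variance_sub_const hX'.aestronglyMeasurable a]
  refine (variance_le_expectation_sq (hX'.sub_const _).aestronglyMeasurable).trans ?_
  simp only [Pi.pow_apply]
  rw [integral_eq_lintegral_of_nonneg_ae (ae_of_all _ fun _ => sq_nonneg _)
    ((hX'.sub_const _).pow_const 2).aestronglyMeasurable]
  refine ENNReal.toReal_le_of_le_ofReal hb ?_
  rw [lintegral_smul_measure, smul_eq_mul, mul_comm, ← div_eq_mul_inv]
  exact (ENNReal.div_le_iff hν0 hνt).2 h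

section posterior

-- Instance search does not identify the norm topology on `LogOdds K` with the product topology.
instance (K : ℕ) : @BorelSpace (LogOdds K)
    (inferInstance :
      NormedAddCommGroup (LogOdds K)).toPseudoMetricSpace.toUniformSpace.toTopologicalSpace
    inferInstance :=
  (inferInstance : BorelSpace (LogOdds K))

variable {K : ℕ} {L : Matrix (Fin K) (Fin K) ℝ} {πq πC : Measure ℝ} {nS : Fin K → ℕ} {nT : ℕ}
  {d : Data K} {q₀ : Fin K → ℝ} {C₀ : Matrix (Fin K) (Fin K) ℝ}

lemma lintegral_unnormalizedPosterior [NeZero K] [SFinite πq] [SFinite πC]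
    (hsize : ∀ o, sizes nS nT o ≠ 0) {g : LogOdds K → ℝ≥0∞} (hg : Measurable g) :
    ∫⁻ x, g (x.1.2, x.2.2) ∂(unnormalizedPosterior L πq πC nS nT d) =
      ENNReal.ofReal
          (∏ o, multinomialProb (sizes nS nT o) (frequencies nS nT d o) (counts d o)) *
        ∫⁻ x, ENNReal.ofReal
            (Real.exp (-deviance (sizes nS nT) (frequencies nS nT d) x.cells)) * g x *
          logOddsDensity L πq πC x ∂(logOddsLebesgue K) := by
  have hcells : Measurable (LogOdds.cells (K := K)) := LogOdds.contDiff_cells.continuous.measurable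
  have hlik (x : Param K) : likelihood nS nT x.q x.conf d =
      (∏ o, multinomialProb (sizes nS nT o) (frequencies nS nT d o) (counts d o)) * Real.exp
        (-deviance (sizes nS nT) (frequencies nS nT d) (LogOdds.cells (x.1.2, x.2.2))) :=
    likelihood_eq_mul_exp_deviance (LogOdds.cells_pos (x.1.2, x.2.2)) hsize d
  simp only [unnormalizedPosterior, hlik, ENNReal.ofReal_mul' (Real.exp_pos _).le]
  rw [lintegral_withDensity_eq_lintegral_mul _ (by fun_prop) (by fun_prop)]
  simp only [Pi.mul_apply, mul_assoc]
  rw [lintegral_const_mul _ (by fun_prop), lintegral_prior (g := fun x => ENNReal.ofReal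
    (Real.exp (-deviance (sizes nS nT) (frequencies nS nT d) x.cells)) * g x) (by fun_prop)]
  simp only [mul_assoc]

lemma unnormalizedPosterior_univ_ne_top [NeZero K] [IsProbabilityMeasure πq]
    [IsProbabilityMeasure πC] (hsize : ∀ o, sizes nS nT o ≠ 0) (hd : d ∈ dataSupport nS nT) :
    unnormalizedPosterior L πq πC nS nT d univ ≠ ∞ := by
  rw [← lintegral_one, lintegral_unnormalizedPosterior hsize (g := fun _ => 1) measurable_const]
  refine ENNReal.mul_ne_top ENNReal.ofReal_ne_top (ne_top_of_le_ne_top ENNReal.one_ne_top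
    ((lintegral_mono fun x => ?_).trans
      (lintegral_logOddsDensity_le_one (L := L) (πq := πq) (πC := πC))))
  rw [mul_one]
  refine mul_le_of_le_one_left' (ENNReal.ofReal_le_one.2 (Real.exp_le_one_iff.2 ?_))
  exact neg_nonpos.2 (deviance_nonneg (fun o => frequencies_mem_stdSimplex hd (hsize o))
    x.cells_mem_stdSimplex x.cells_pos)

lemma exists_lintegral_deviance_unnormalizedPosterior_le (hq : ∀ i, 0 < q₀ i)
    (hq1 : ∑ i, q₀ i = 1) (hC : ∀ j i, 0 < C₀ j i) (hC1 : ∀ i, ∑ j, C₀ j i = 1)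
    (hdet : C₀.det ≠ 0) [NeZero K] :
    ∃ c : ℝ≥0, ∀ L : Matrix (Fin K) (Fin K) ℝ, IsPosDefOnCentred L →
      ∀ πq πC : Measure ℝ, IsHyperprior πq → IsHyperprior πC → ∀ ρ > (0 : ℝ),
      ∃ ε > 0, ∃ N₀ : ℕ, ∀ (nS : Fin K → ℕ) (nT : ℕ), N₀ ≤ ∑ o, sizes nS nT o →
        (∀ o, ρ * ∑ o, (sizes nS nT o : ℝ) ≤ sizes nS nT o) → (∀ o, sizes nS nT o ≠ 0) →
        ∀ d ∈ dataSupport nS nT, frequencies nS nT d ∈ ball (cells q₀ C₀) ε →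
          unnormalizedPosterior L πq πC nS nT d univ ≠ 0 ∧
          ∫⁻ x, ENNReal.ofReal (deviance (sizes nS nT) (frequencies nS nT d)
              (LogOdds.cells (x.1.2, x.2.2))) ∂(unnormalizedPosterior L πq πC nS nT d) ≤
            c * unnormalizedPosterior L πq πC nS nT d univ := by
  have hcells : Continuous (LogOdds.cells (K := K)) := LogOdds.contDiff_cells.continuous
  obtain ⟨r, hr, A, hchart⟩ := exists_isLipschitzChart_cells hq hC hdet
  rw [← cells_logOdds hq hq1 hC hC1] at hchart ⊢
  refine ⟨4 * (2 * A ^ 2) ^ Module.finrank ℝ (LogOdds K) + 1,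
    fun L hL πq πC hπq hπC ρ hρ => ?_⟩
  have := hπq.prob
  have := hπC.prob
  have hπ := continuous_logOddsDensity hL hπq hπC
  obtain ⟨ε, hε, N₀, h⟩ := hchart.exists_lintegral_deviance_le (logOddsLebesgue K) hr hcells
    LogOdds.cells_pos hπ.measurable lintegral_logOddsDensity_le_one hπ.continuousAt
    (logOddsDensity_ne_zero hL hπq hπC _) (logOddsDensity_ne_top hL hπq hπC _) hρ
  refine ⟨ε, hε, N₀, fun nS nT hN hρN hsize d hd hfreq => ?_⟩
  obtain ⟨hpos, hle⟩ := h (sizes nS nT) hN hρN _ hfreq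
    fun o => frequencies_mem_stdSimplex hd (hsize o)
  have huniv := lintegral_unnormalizedPosterior (L := L) (πq := πq) (πC := πC) (d := d) hsize
    (g := fun _ => 1) measurable_const
  simp only [lintegral_one, mul_one] at huniv
  rw [huniv, lintegral_unnormalizedPosterior hsize (g := fun x => ENNReal.ofReal
    (deviance (sizes nS nT) (frequencies nS nT d) x.cells)) (by fun_prop), mul_left_comm]
  refine ⟨mul_ne_zero (ENNReal.ofReal_pos.2 (prod_multinomialProb_frequencies_pos hd hsize)).ne'
    hpos, ?_⟩
  gcongr
  simpa only [← ENNReal.ofReal_mul (Real.exp_pos _).le, mul_comm (Real.exp _), ENNReal.coe_add,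
    ENNReal.coe_mul, ENNReal.coe_pow, ENNReal.coe_ofNat, ENNReal.coe_one] using hle

lemma exists_mul_sq_sub_classPrior_le_deviance (hq : ∀ i, 0 < q₀ i) (hq1 : ∑ i, q₀ i = 1)
    (hC : ∀ j i, 0 < C₀ j i) (hC1 : ∀ i, ∑ j, C₀ j i = 1) (hdet : C₀.det ≠ 0) [NeZero K] :
    ∃ r > 0, ∃ A : ℝ≥0, ∀ f ∈ ball (cells q₀ C₀) r, (∀ o, f o ∈ stdSimplex ℝ (Fin K)) →
      ∀ (n : Option (Fin K) → ℕ) (m : ℝ), 0 ≤ m → (∀ o, m ≤ n o) → ∀ (x : LogOdds K) (i : Fin K),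
        m * (x.q i - classPrior f i) ^ 2 ≤ A * deviance n f x.cells := by
  obtain ⟨r, hr, A, hA⟩ := exists_dist_q_classPrior_le hq hq1 hC hC1 hdet
  refine ⟨r, hr, 4 * A ^ 2, fun f hf hf1 n m hm hmn x i => ?_⟩
  have hdist : |x.q i - classPrior f i| ≤ A * dist x.cells f :=
    (dist_le_pi_dist _ _ i).trans (hA f hf x)
  calc m * (x.q i - classPrior f i) ^ 2 = m * |x.q i - classPrior f i| ^ 2 := by rw [sq_abs]
    _ ≤ m * (A * dist x.cells f) ^ 2 := by gcongr
    _ = A ^ 2 * (m * dist x.cells f ^ 2) := by ring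
    _ ≤ A ^ 2 * (4 * deviance n f x.cells) := by
        gcongr _ * ?_
        exact mul_dist_sq_le_deviance hf1 x.cells_mem_stdSimplex x.cells_pos hm hmn
    _ = _ := by push_cast; ring

lemma posteriorVar_le [NeZero K] [IsProbabilityMeasure πq] [IsProbabilityMeasure πC]
    (hsize : ∀ o, sizes nS nT o ≠ 0) (hd : d ∈ dataSupport nS nT)
    (h0 : unnormalizedPosterior L πq πC nS nT d univ ≠ 0) {c κ : ℝ≥0}
    (hc : ∫⁻ x, ENNReal.ofReal (deviance (sizes nS nT) (frequencies nS nT d)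
        (LogOdds.cells (x.1.2, x.2.2))) ∂(unnormalizedPosterior L πq πC nS nT d) ≤
      c * unnormalizedPosterior L πq πC nS nT d univ) {i : Fin K} {a : ℝ}
    (hκ : ∀ x : LogOdds K, (x.q i - a) ^ 2 ≤
      κ * deviance (sizes nS nT) (frequencies nS nT d) x.cells) :
    posteriorVar L πq πC nS nT d i ≤ κ * c := by
  have hX : Measurable fun x : Param K => x.q i :=
    ((measurable_pi_apply i).comp (LogOdds.contDiff_q (K := K)).continuous.measurable).comp
      (measurable_fst.snd.prodMk measurable_snd.snd)
  refine variance_inv_smul_le (a := a) hX.aemeasurable (by positivity) h0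
    (unnormalizedPosterior_univ_ne_top hsize hd) ?_
  calc _ ≤ ∫⁻ x, κ * ENNReal.ofReal (deviance (sizes nS nT) (frequencies nS nT d)
        (LogOdds.cells (x.1.2, x.2.2))) ∂(unnormalizedPosterior L πq πC nS nT d) := by
        refine lintegral_mono fun x => ?_
        rw [← ENNReal.ofReal_coe_nnreal, ← ENNReal.ofReal_mul κ.coe_nonneg]
        exact ENNReal.ofReal_le_ofReal (hκ (x.1.2, x.2.2))
    _ ≤ κ * (c * unnormalizedPosterior L πq πC nS nT d univ) := by
        rw [lintegral_const_mul' _ _ ENNReal.coe_ne_top]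
        gcongr
    _ = _ := by
        rw [ENNReal.ofReal_mul κ.coe_nonneg, ENNReal.ofReal_coe_nnreal,
          ENNReal.ofReal_coe_nnreal, mul_assoc]

lemma exists_posteriorVar_le (hq : ∀ i, 0 < q₀ i) (hq1 : ∑ i, q₀ i = 1)
    (hC : ∀ j i, 0 < C₀ j i) (hC1 : ∀ i, ∑ j, C₀ j i = 1) (hdet : C₀.det ≠ 0) [NeZero K] :
    ∃ B > (0 : ℝ), ∀ L : Matrix (Fin K) (Fin K) ℝ, IsPosDefOnCentred L →
      ∀ πq πC : Measure ℝ, IsHyperprior πq → IsHyperprior πC → ∀ ρ > (0 : ℝ),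
      ∃ ε > 0, ∃ N₀ : ℕ, ∀ (nS : Fin K → ℕ) (nT : ℕ), N₀ ≤ ∑ o, sizes nS nT o →
        (∀ o, ρ * ∑ o, (sizes nS nT o : ℝ) ≤ sizes nS nT o) →
        ∀ d ∈ dataSupport nS nT, dist (frequencies nS nT d) (cells q₀ C₀) < ε →
          IsProbabilityMeasure (posterior L πq πC nS nT d) ∧ ∀ i,
            posteriorVar L πq πC nS nT d i ≤ B / (ρ * ∑ o, (sizes nS nT o : ℝ)) := by
  obtain ⟨c, hc⟩ := exists_lintegral_deviance_unnormalizedPosterior_le hq hq1 hC hC1 hdet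
  obtain ⟨r, hr, A, hA⟩ := exists_mul_sq_sub_classPrior_le_deviance hq hq1 hC hC1 hdet
  refine ⟨A * c + 1, by positivity, fun L hL πq πC hπq hπC ρ hρ => ?_⟩
  have := hπq.prob
  have := hπC.prob
  obtain ⟨ε, hε, N₀, h⟩ := hc L hL πq πC hπq hπC ρ hρ
  refine ⟨min ε r, lt_min hε hr, max N₀ 1, fun nS nT hN hρN d hd hfreq => ?_⟩
  have hNpos : (0 : ℝ) < ∑ o, (sizes nS nT o : ℝ) := by
    exact_mod_cast Nat.lt_of_succ_le ((le_max_right _ _).trans hN)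
  have hρNpos : 0 < ρ * ∑ o, (sizes nS nT o : ℝ) := mul_pos hρ hNpos
  have hsize (o : Option (Fin K)) : sizes nS nT o ≠ 0 :=
    Nat.cast_ne_zero.1 (hρNpos.trans_le (hρN o)).ne'
  obtain ⟨hpos, hle⟩ := h nS nT ((le_max_left _ _).trans hN) hρN hsize d hd
    (hfreq.trans_le (min_le_left _ _))
  refine ⟨isProbabilityMeasure_inv_smul hpos (unnormalizedPosterior_univ_ne_top hsize hd),
    fun i => (posteriorVar_le (κ := A / (ρ * ∑ o, (sizes nS nT o : ℝ)).toNNReal) hsize hd hpos hle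
      (a := classPrior (frequencies nS nT d) i) fun x => ?_).trans ?_⟩
  · have hdev := hA _ (hfreq.trans_le (min_le_right _ _))
      (fun o => frequencies_mem_stdSimplex hd (hsize o)) (sizes nS nT) _ hρNpos.le hρN x i
    rwa [NNReal.coe_div, Real.coe_toNNReal _ hρNpos.le, div_mul_eq_mul_div, le_div_iff₀ hρNpos,
      mul_comm]
  · rw [NNReal.coe_div, Real.coe_toNNReal _ hρNpos.le, div_mul_eq_mul_div]
    gcongr
    linarith

end posterior

end GSBBSE

theorem mainTheorem4_general {K : ℕ} {q₀ : Fin K → ℝ} (hq₀ : ∀ i, 0 < q₀ i)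
    (hq₀_sum : ∑ i, q₀ i = 1) {C₀ : Matrix (Fin K) (Fin K) ℝ} (hC₀ : ∀ j i, 0 < C₀ j i)
    (hC₀_sum : ∀ i, ∑ j, C₀ j i = 1) (hC₀_det : C₀.det ≠ 0) :
    ∃ B : ℝ, 0 < B ∧
      ∀ L : Matrix (Fin K) (Fin K) ℝ, GSBBSE.IsPosDefOnCentred L →
      ∀ πq πC : Measure ℝ, GSBBSE.IsHyperprior πq → GSBBSE.IsHyperprior πC →
      ∀ ρ : ℝ, 0 < ρ → ∀ δ : ℝ, 0 < δ →
      ∃ N₀ : ℕ, ∀ (N : ℕ) (nS : Fin K → ℕ) (nT : ℕ),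
        N = nT + ∑ i, nS i → N₀ ≤ N →
        ρ * N ≤ nT → (∀ i, ρ * N ≤ nS i) →
        1 - δ ≤ (GSBBSE.dataLaw nS nT q₀ C₀).real
          {d | IsProbabilityMeasure (GSBBSE.posterior L πq πC nS nT d) ∧
              ∀ i, GSBBSE.posteriorVar L πq πC nS nT d i ≤ B / (ρ * N)} := by
  have : NeZero K := ⟨by rintro rfl; simp at hq₀_sum⟩
  obtain ⟨B, hB, h⟩ := GSBBSE.exists_posteriorVar_le hq₀ hq₀_sum hC₀ hC₀_sum hC₀_det
  refine ⟨B, hB, fun L hL πq πC hπq hπC ρ hρ δ hδ => ?_⟩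
  obtain ⟨ε, hε, N₁, hpost⟩ := h L hL πq πC hπq hπC ρ hρ
  obtain ⟨N₂, hdata⟩ := GSBBSE.exists_dataLaw_real_ge_of_dist_frequencies_lt
    (GSBBSE.cells_mem_stdSimplex hq₀ hq₀_sum hC₀ hC₀_sum) hε hρ hδ
  refine ⟨max N₁ N₂, fun N nS nT hN hNN hT hS => ?_⟩
  rw [← GSBBSE.sum_sizes] at hN
  subst hN
  push_cast at hT hS ⊢
  have hsizes (o : Option (Fin K)) : ρ * ∑ o, (GSBBSE.sizes nS nT o : ℝ) ≤
      GSBBSE.sizes nS nT o := by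
    cases o with
    | none => exact hT
    | some i => exact hS i
  exact hdata nS nT ((le_max_right _ _).trans hNN) hsizes _
    (hpost nS nT ((le_max_left _ _).trans hNN) hsizes)

theorem mainTheorem4 (K : ℕ) (hK : 2 ≤ K)
    (q₀ : Fin K → ℝ) (hq₀ : ∀ i, 0 < q₀ i) (hq₀_sum : ∑ i, q₀ i = 1)
    (C₀ : Matrix (Fin K) (Fin K) ℝ) (hC₀ : ∀ j i, C₀ j i ∈ Set.Ioo (0 : ℝ) 1)
    (hC₀_sum : ∀ i, ∑ j, C₀ j i = 1) (hC₀_det : C₀.det ≠ 0) :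
    ∃ C : ℝ, 0 < C ∧
      ∀ (W : Matrix (Fin K) (Fin K) ℝ), GSBBSE.IsConnectedLabelGraph W →
      ∀ (πq : Measure ℝ), GSBBSE.IsFixedOrGamma πq →
      ∀ (aC bC : ℝ), 0 < aC → 0 < bC →
      ∀ (ρ : ℝ), 0 < ρ → ∀ (δ : ℝ), 0 < δ →
      ∃ N₀ : ℕ, ∀ (N : ℕ) (nS : Fin K → ℕ) (nT : ℕ),
        N = nT + ∑ i, nS i → N₀ ≤ N →
        ρ * N ≤ nT → (∀ i, ρ * N ≤ nS i) →
        1 - δ ≤ (GSBBSE.dataLaw nS nT q₀ C₀).real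
          {d | IsProbabilityMeasure
                (GSBBSE.posterior (GSBBSE.laplacian W) πq (gammaMeasure aC bC) nS nT d) ∧
              ∀ i, GSBBSE.posteriorVar (GSBBSE.laplacian W) πq (gammaMeasure aC bC) nS nT d i
                ≤ C / (ρ * GSBBSE.lambda2 (GSBBSE.laplacian W) * N)} := by
  have hC₀_pos := fun j i => (hC₀ j i).1
  obtain ⟨B, hB, h⟩ := mainTheorem4_general hq₀ hq₀_sum hC₀_pos hC₀_sum hC₀_det
  refine ⟨B * (2 * K), by positivity, fun W hW πq hπq aC bC haC hbC ρ hρ δ hδ => ?_⟩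
  obtain ⟨N₀, hN₀⟩ := h _ hW.isPosDefOnCentred_laplacian πq _ hπq.isHyperprior
    (GSBBSE.isHyperprior_gammaMeasure haC hbC) ρ hρ δ hδ
  refine ⟨N₀, fun N nS nT hN hNN hT hS => (hN₀ N nS nT hN hNN hT hS).trans ?_⟩
  have := GSBBSE.isProbabilityMeasure_dataLaw (nS := nS) (nT := nT)
    (GSBBSE.cells_mem_stdSimplex hq₀ hq₀_sum hC₀_pos hC₀_sum)
  refine measureReal_mono fun d ⟨hprob, hvar⟩ => ⟨hprob, fun i => (hvar i).trans ?_⟩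
  rw [mul_comm ρ (GSBBSE.lambda2 _), mul_assoc]
  exact hW.div_le_div_lambda2 hK hB.le (by positivity)
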